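/- **Theorem.** Let $a,b\in\mathbb R$ with $a>-1$, $b>-1$ and $\alpha:=a+b>-1$. Let $(p_n)_{n\ge0}$, $(q_n)_{n\ge 0}$ be the real polynomials with $\deg p_n=\deg q_n=n$, with identical positive leading coefficients, and with $$\int_0^\infty\!\!\int_0^\infty p_\ell(x)\,q_m(y)\,\frac{x^a y^b e^{-x-y}}{x+y}\,dx\,dy=\delta_{\ell m}\qquad(\ell,m\ge 0).$$ Put $$\pi_n:=\sqrt{2n+\alpha+1}\,\sqrt{\frac{\Gamma(a+n+1)}{\Gamma(b+n+1)}} .$$ Then for every $n\ge 0$ and every $z\in\mathbb C\setminus(-\infty,0]$ the auxiliary function of the second kind $$p_n^{(2)}(z):=-\int_0^\infty\!\!\int_0^\infty \frac{p_n(x)\,x^a y^b e^{-x-y}}{(x+y)(z+y)}\,dx\,dy$$ is given by an absolutely convergent integral, and $$p_n^{(2)}(z)=(-1)^{n+1}\,\pi_n\;G^{3,1}_{2,3}\!\left(\left.{-n,\ \alpha+n+1\atop 0,\ \alpha,\ b}\;\right|\,z\right),$$ where the Meijer $G$-function is the absolutely convergent Mellin–Barnes integral $$G^{3,1}_{2,3}\!\left(\left.{-n,\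 \alpha+n+1\atop 0,\ \alpha,\ b}\;\right|\,z\right)=\int_\gamma\frac{du}{2\pi i}\,\frac{\Gamma(u)\,\Gamma(\alpha+u)\,\Gamma(b+u)\,\Gamma(n+1-u)}{\Gamma(\alpha+n+1+u)}\,z^{-u}$$ with the principal branch of $z^{-u}$. Here $\gamma$ is any contour $\gamma_{\sigma,\tau}$ with $\tau>0$ and $\max(0,-\alpha,-b)<\sigma<n+1$: it runs from $-\infty-i\tau$ horizontally to $\sigma-i\tau$, vertically to $\sigma+i\tau$, and horizontally back to $-\infty+i\tau$, so that it encircles all poles of $\Gamma(u)$, $\Gamma(\alpha+u)$, $\Gamma(b+u)$ and none of the poles of $\Gamma(n+1-u)$. The value does not depend on $\sigma$ and $\tau$. -/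

import Mathlib

open Set MeasureTheory Polynomial

noncomputable section

/-- `(p, q)` are the biorthonormal polynomials of the pairing
`⟨f, g⟩ = ∬_{x, y > 0} f(x) g(y) x^a y^b e^{-x-y} / (x + y) dx dy`: `p n` and `q n` have degree `n`
and the same positive leading coefficient, and `⟨p l, q m⟩ = δ_{lm}`. -/
structure IsCauchyLaguerreBiorthonormal (a b : ℝ) (p q : ℕ → ℝ[X]) : Prop where
  natDegree_left : ∀ n, (p n).natDegree = n
  natDegree_right : ∀ n, (q n).natDegree = n
  leadingCoeff_eq : ∀ n, (p n).leadingCoeff = (q n).leadingCoeff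
  leadingCoeff_pos : ∀ n, 0 < (p n).leadingCoeff
  pairing : ∀ l m, ∫ w in Ioi (0 : ℝ) ×ˢ Ioi (0 : ℝ),
    (p l).eval w.1 * (q m).eval w.2 * (w.1 ^ a * w.2 ^ b * Real.exp (-w.1 - w.2) / (w.1 + w.2))
      = if l = m then 1 else 0

/-- The integrand of the auxiliary function of the second kind, at `w = (x, y)`:
`f(x) x^a y^b e^{-x-y} / ((x + y) (z + y))`. -/
def auxSecondIntegrand (a b : ℝ) (f : ℝ[X]) (z : ℂ) (w : ℝ × ℝ) : ℂ :=
  ((f.eval w.1 * w.1 ^ a * w.2 ^ b * Real.exp (-w.1 - w.2) : ℝ) : ℂ) /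
    (((w.1 + w.2 : ℝ) : ℂ) * (z + (w.2 : ℂ)))

/-- The auxiliary function of the second kind attached to the polynomial `f`. -/
def auxSecond (a b : ℝ) (f : ℝ[X]) (z : ℂ) : ℂ :=
  -∫ w in Ioi (0 : ℝ) ×ˢ Ioi (0 : ℝ), auxSecondIntegrand a b f z w

/-- The normalization constant `√(2n + α + 1) √(Γ(a + n + 1) / Γ(b + n + 1))`, `α = a + b`. -/
def normConst (a b : ℝ) (n : ℕ) : ℝ :=
  √(2 * n + (a + b) + 1) * √(Real.Gamma (a + n + 1) / Real.Gamma (b + n + 1))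

/-- The Mellin-Barnes integrand
`∏_{j ≤ m} Γ(b_j + u) ∏_{j ≤ n} Γ(1 - a_j - u) /
  (∏_{j > m} Γ(1 - b_j - u) ∏_{j > n} Γ(a_j + u)) · z^{-u}` with the principal branch of `z^{-u}`.
The values `Γ(-k) = 0` and `0⁻¹ = 0` make `Γ⁻¹` the entire reciprocal Gamma function. -/
def meijerIntegrand (m n : ℕ) {p q : ℕ} (a : Fin p → ℂ) (b : Fin q → ℂ) (z u : ℂ) : ℂ :=
  (∏ j : Fin q, if (j : ℕ) < m then Complex.Gamma (b j + u)
    else (Complex.Gamma (1 - b j - u))⁻¹) *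
  (∏ j : Fin p, if (j : ℕ) < n then Complex.Gamma (1 - a j - u)
    else (Complex.Gamma (a j + u))⁻¹) * z ^ (-u)

/-- The loop with parameters `σ` and `τ > 0` comes from `-∞ - iτ` along a horizontal line to
`σ - iτ`, goes up to `σ + iτ`, and returns horizontally to `-∞ + iτ`. It is admissible if it
encircles all poles `-b_j - k` of the `Γ(b_j + u)`, `j ≤ m`, while the poles `1 - a_j + k` of the
`Γ(1 - a_j - u)`, `j ≤ n`, lie strictly outside. -/
structure IsMeijerLoop (m n : ℕ) {p q : ℕ} (a : Fin p → ℂ) (b : Fin q → ℂ) (σ τ : ℝ) : Prop where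
  pos : 0 < τ
  inside : ∀ j : Fin q, (j : ℕ) < m → ∀ k : ℕ, (-b j - k).re < σ ∧ |(-b j - k).im| < τ
  outside : ∀ j : Fin p, (j : ℕ) < n → ∀ k : ℕ, σ < (1 - a j + k).re ∨ τ < |(1 - a j + k).im|

/-- `f` is absolutely integrable along the loop with parameters `σ`, `τ`. -/
def LoopIntegrable (f : ℂ → ℂ) (σ τ : ℝ) : Prop :=
  IntegrableOn (fun x : ℝ => f (x - τ * Complex.I)) (Iic σ) ∧
  IntervalIntegrable (fun y : ℝ => f (σ + y * Complex.I)) volume (-τ) τ ∧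
  IntegrableOn (fun x : ℝ => f (x + τ * Complex.I)) (Iic σ)

/-- The integral of `f(u) du / (2πi)` along the loop with parameters `σ`, `τ`. -/
def loopIntegral (f : ℂ → ℂ) (σ τ : ℝ) : ℂ :=
  (2 * (Real.pi : ℂ) * Complex.I)⁻¹ *
    ((∫ x in Iic σ, f (x - τ * Complex.I)) +
      Complex.I * (∫ y in (-τ)..τ, f (σ + y * Complex.I)) -
      ∫ x in Iic σ, f (x + τ * Complex.I))

/-- The Meijer `G`-function `G^{m,n}_{p,q}(a_1, …, a_p; b_1, …, b_q | z)` is defined and has the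
value `g`: there is an admissible loop, and along every admissible loop the Mellin-Barnes integral
converges absolutely and equals `g`. This is the definition for `p ≤ q` (loops from and to `-∞`) in
the case that the two families of poles can be separated by a rectangular loop, as is always the
case when a vertical line separates them; deforming the loop does not change the integral. -/
def HasMeijerG (m n : ℕ) {p q : ℕ} (a : Fin p → ℂ) (b : Fin q → ℂ) (z g : ℂ) : Prop :=
  (∃ σ τ, IsMeijerLoop m n a b σ τ) ∧
  ∀ σ τ, IsMeijerLoop m n a b σ τ →
    LoopIntegrable (meijerIntegrand m n a b z) σ τ ∧
      loopIntegral (meijerIntegrand m n a b z) σ τ = g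

end

noncomputable section

open Filter Topology

/-! On a line `Re u = c` with `max(0, -α, -b) < c < 1`, the kernel has the Mellin–Barnes form `y /
(z + y) = (2πi)⁻¹ ∫ Γ(u) Γ(1 - u) z^{-u} y^u du` (`div_add_eq_integral`). Inserting it in the
auxiliary function and exchanging integrals leaves the integral of `p_n(x) x^a y^{b+u-1} e^{-x-y} /
(x + y)`. By the explicit Cauchy–Laguerre moments (`integral_cauchy_moment`) this equals `Γ(b + u)
F(α + u)`, where `F(s) = ∑ c_j Γ(a + j + 1) / (s + j)` and `c_j` are the coefficients of `p_n`.

Orthogonality of `p_n` to `y^k`, `k < n`, says `F(α + k + 1) = 0`. A partial fraction with poles `0,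
-1, …, -n` and these `n` zeros is known up to a constant: `F(s) = D ∏ (s - α - k - 1) / ∏ (s + j)`.
The residue at `-n` ties `D` to the leading coefficient, and `⟨p_n, q_n⟩ = 1` then forces `D = π_n`
(`IsCauchyLaguerreBiorthonormal.cauchyMoment_eq`). At `s = α + u` the products are `(-1)^n (1 -
u)_n` and `(α + u)_{n+1}`. They turn `Γ(1 - u)` into `Γ(n + 1 - u)` and supply `Γ(α + u) / Γ(α + n +
1 + u)`, which is the Meijer integrand.

It remains to pass from the vertical line to an arbitrary admissible loop (`hasMeijerG_vertical`).
The product `Γ(u) Γ(1 - u)` decays like `e^{-π |Im u|}`, which beats the growth `e^{|arg z| |Im u|}`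
of `z^{-u}` off the cut. Away from the real axis `Γ(b + u)` decays to the left faster than any
exponential. Cauchy's theorem therefore rotates the horizontal rays into the tails of a vertical
line and moves that line inside the pole-free strip. -/

/-! ### Contour deformation for exponentially decaying functions -/

theorem integrable_exp_neg_mul_abs {δ : ℝ} (hδ : 0 < δ) :
    Integrable (fun y : ℝ => Real.exp (-δ * |y|)) := by
  have h1 : IntegrableOn (fun y : ℝ => Real.exp (-δ * |y|)) (Ioi 0) := by
    refine (integrableOn_exp_mul_Ioi (a := -δ) (by linarith) 0).congr_fun (fun y hy => ?_)
      measurableSet_Ioi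
    simp only [abs_of_pos (mem_Ioi.1 hy)]
  have h2 : IntegrableOn (fun y : ℝ => Real.exp (-δ * |y|)) (Iic 0) := by
    refine (integrableOn_exp_mul_Iic hδ 0).congr_fun (fun y hy => ?_) measurableSet_Iic
    simp only [abs_of_nonpos (mem_Iic.1 hy)]
    ring_nf
  rw [← integrableOn_univ, ← Iic_union_Ioi (a := (0 : ℝ))]
  exact h2.union h1

/-- A continuous function on `ℝ` with exponential decay is integrable. -/
theorem Continuous.integrable_of_exp_decay {g : ℝ → ℂ} (hg : Continuous g) {C δ : ℝ} (hδ : 0 < δ)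
    (hb : ∀ y, 1 ≤ |y| → ‖g y‖ ≤ C * Real.exp (-δ * |y|)) : Integrable g := by
  obtain ⟨K, hK⟩ := isCompact_Icc.exists_bound_of_continuousOn (s := Icc (-1 : ℝ) 1) hg.continuousOn
  have hK0 : 0 ≤ K := (norm_nonneg _).trans (hK 0 (by simp))
  have hC0 : 0 ≤ C := by
    have := (norm_nonneg _).trans (hb 1 (by simp))
    exact nonneg_of_mul_nonneg_left this (Real.exp_pos _)
  -- The term `C` serves `|y| ≥ 1`. For `|y| ≤ 1` the factor `e^δ e^{-δ|y|}` is at least `1`, so the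
  -- other term dominates the compact bound `K`.
  refine ((integrable_exp_neg_mul_abs hδ).const_mul (C + K * Real.exp δ)).mono'
    hg.aestronglyMeasurable (Eventually.of_forall fun y => ?_)
  have he := Real.exp_pos (-δ * |y|)
  rcases le_total 1 |y| with h | h
  · have : 0 ≤ K * Real.exp δ * Real.exp (-δ * |y|) := by positivity
    linarith [hb y h]
  · have h1 : 1 ≤ Real.exp δ * Real.exp (-δ * |y|) := by
      rw [← Real.exp_add]
      exact Real.one_le_exp (by nlinarith)
    have h2 := hK y (abs_le.1 h)
    have h3 : 0 ≤ C * Real.exp (-δ * |y|) := by positivity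
    nlinarith

theorem re_ofReal_add_mul_I (x y : ℝ) : ((x : ℂ) + y * Complex.I).re = x := by simp

theorem im_ofReal_add_mul_I (x y : ℝ) : ((x : ℂ) + y * Complex.I).im = y := by simp

theorem continuous_vertical {f : ℂ → ℂ} {c : ℝ}
    (hf : ∀ u : ℂ, u.re = c → DifferentiableAt ℂ f u) :
    Continuous (fun y : ℝ => f (c + y * Complex.I)) := by
  refine continuous_iff_continuousAt.2 fun y => ?_
  refine ContinuousAt.comp (g := f) (hf _ (by simp)).continuousAt ?_
  fun_prop

theorem integrable_vertical {f : ℂ → ℂ} {c C δ : ℝ} (hδ : 0 < δ)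
    (hf : ∀ u : ℂ, u.re = c → DifferentiableAt ℂ f u)
    (hb : ∀ u : ℂ, u.re = c → 1 ≤ |u.im| → ‖f u‖ ≤ C * Real.exp (-δ * |u.im|)) :
    Integrable (fun y : ℝ => f (c + y * Complex.I)) := by
  refine (continuous_vertical hf).integrable_of_exp_decay (C := C) hδ fun y hy => ?_
  simpa using hb (c + y * Complex.I) (by simp) (by simpa using hy)

/-- The Cauchy theorem for a vertical strip. -/
theorem integral_vertical_eq_of_exp_decay {f : ℂ → ℂ} {c₁ c₂ C δ : ℝ} (hc : c₁ ≤ c₂) (hδ : 0 < δ)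
    (hf : ∀ u : ℂ, c₁ ≤ u.re → u.re ≤ c₂ → DifferentiableAt ℂ f u)
    (hb : ∀ u : ℂ, c₁ ≤ u.re → u.re ≤ c₂ → 1 ≤ |u.im| → ‖f u‖ ≤ C * Real.exp (-δ * |u.im|)) :
    ∫ y : ℝ, f (c₁ + y * Complex.I) = ∫ y : ℝ, f (c₂ + y * Complex.I) := by
  have i1 := integrable_vertical hδ (fun u hu => hf u hu.ge (hu.le.trans hc))
    (fun u hu => hb u hu.ge (hu.le.trans hc))
  have i2 := integrable_vertical hδ (fun u hu => hf u (hc.trans hu.ge) hu.le)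
    (fun u hu => hb u (hc.trans hu.ge) hu.le)
  have t1 := intervalIntegral_tendsto_integral i1 tendsto_neg_atTop_atBot tendsto_id
  have t2 := intervalIntegral_tendsto_integral i2 tendsto_neg_atTop_atBot tendsto_id
  -- The sign `s` selects the top or the bottom edge of the rectangle; both vanish in the limit.
  have hh : ∀ s : ℝ, s = 1 ∨ s = -1 → Tendsto (fun T : ℝ =>
      ∫ x in c₁..c₂, f (x + (s * T : ℝ) * Complex.I)) atTop (𝓝 0) := by
    intro s hs
    have hz : Tendsto (fun T : ℝ => C * Real.exp (-δ * T) * |c₂ - c₁|) atTop (𝓝 0) := by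
      have : Tendsto (fun T : ℝ => Real.exp (-δ * T)) atTop (𝓝 0) :=
        Real.tendsto_exp_atBot.comp (tendsto_id.const_mul_atTop_of_neg (by linarith))
      simpa using (this.const_mul C).mul_const |c₂ - c₁|
    refine squeeze_zero_norm' ?_ hz
    filter_upwards [eventually_ge_atTop 1] with T hT
    have hsT : |s * T| = T := by
      rcases hs with rfl | rfl
      · rw [one_mul, abs_of_nonneg (by linarith)]
      · rw [neg_one_mul, abs_neg, abs_of_nonneg (by linarith)]
    refine intervalIntegral.norm_integral_le_of_norm_le_const fun x hx => ?_
    rw [uIoc_of_le hc] at hx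
    have := hb (x + (s * T : ℝ) * Complex.I) (by rw [re_ofReal_add_mul_I]; exact hx.1.le)
      (by rw [re_ofReal_add_mul_I]; exact hx.2) (by rw [im_ofReal_add_mul_I, hsT]; exact hT)
    rwa [im_ofReal_add_mul_I, hsT] at this
  have key : ∀ T : ℝ, (∫ x in c₁..c₂, f (x + ((-1) * T : ℝ) * Complex.I)) -
      (∫ x in c₁..c₂, f (x + (1 * T : ℝ) * Complex.I)) +
      Complex.I * (∫ y in (-T)..T, f (c₂ + y * Complex.I)) -
      Complex.I * (∫ y in (-T)..T, f (c₁ + y * Complex.I)) = 0 := by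
    intro T
    have := Complex.integral_boundary_rect_eq_zero_of_differentiableOn f
      (c₁ + (-T : ℝ) * Complex.I) (c₂ + (T : ℝ) * Complex.I) (fun u hu => by
        rw [Complex.mem_reProdIm, re_ofReal_add_mul_I, re_ofReal_add_mul_I, uIcc_of_le hc] at hu
        exact (hf u hu.1.1 hu.1.2).differentiableWithinAt)
    simpa only [re_ofReal_add_mul_I, im_ofReal_add_mul_I, neg_one_mul, one_mul, smul_eq_mul] using this
  have lim := ((((hh (-1) (Or.inr rfl)).sub (hh 1 (Or.inl rfl))).add (t2.const_mul Complex.I)).sub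
    (t1.const_mul Complex.I))
  have l0 := tendsto_nhds_unique lim (tendsto_const_nhds.congr fun T => (key T).symm)
  have : Complex.I * ((∫ y : ℝ, f (c₂ + y * Complex.I)) - ∫ y : ℝ, f (c₁ + y * Complex.I)) = 0 := by
    linear_combination l0
  rcases mul_eq_zero.1 this with h | h
  · exact absurd h Complex.I_ne_zero
  · exact (sub_eq_zero.1 h).symm

/-- An exponentially decaying function on a half-strip is integrable along its horizontal rays, and
the integral along such a ray can be rotated to a vertical one. -/
theorem integral_ray_eq_of_exp_decay {f : ℂ → ℂ} {σ τ C δ s : ℝ} (hs : s = 1 ∨ s = -1)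
    (hδ : 0 < δ) (hτ : 0 < τ)
    (hf : ∀ u : ℂ, u.re ≤ σ → u.im ≠ 0 → DifferentiableAt ℂ f u)
    (hb : ∀ u : ℂ, u.re ≤ σ → τ ≤ |u.im| →
      ‖f u‖ ≤ C * Real.exp (-δ * |u.im|) * Real.exp u.re) :
    IntegrableOn (fun x : ℝ => f (x + (s * τ : ℝ) * Complex.I)) (Iic σ) ∧
    IntegrableOn (fun y : ℝ => f (σ + (s * y : ℝ) * Complex.I)) (Ioi τ) ∧
    ∫ x in Iic σ, f (x + (s * τ : ℝ) * Complex.I) =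
      -Complex.I * s * ∫ y in Ioi τ, f (σ + (s * y : ℝ) * Complex.I) := by
  have hs0 : s ≠ 0 := by rcases hs with rfl | rfl <;> norm_num
  have hsa : ∀ T, 0 ≤ T → |s * T| = T := by
    intro T hT
    rcases hs with rfl | rfl
    · rw [one_mul, abs_of_nonneg hT]
    · rw [neg_one_mul, abs_neg, abs_of_nonneg hT]
  have hC : 0 ≤ C := by
    have := (norm_nonneg _).trans
      (hb (σ + (τ : ℝ) * Complex.I) (by simp) (by simpa using le_abs_self τ))
    rw [mul_assoc] at this
    exact nonneg_of_mul_nonneg_left this (by positivity)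
  have bd : ∀ x T : ℝ, x ≤ σ → τ ≤ T → ‖f (x + (s * T : ℝ) * Complex.I)‖ ≤
      C * Real.exp (-δ * T) * Real.exp x := by
    intro x T hx hT
    have := hb (x + (s * T : ℝ) * Complex.I) (by rwa [re_ofReal_add_mul_I])
      (by rwa [im_ofReal_add_mul_I, hsa T (hτ.le.trans hT)])
    rwa [re_ofReal_add_mul_I, im_ofReal_add_mul_I, hsa T (hτ.le.trans hT)] at this
  have df : ∀ x T : ℝ, x ≤ σ → τ ≤ T → DifferentiableAt ℂ f (x + (s * T : ℝ) * Complex.I) := by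
    intro x T hx hT
    refine hf _ (by rwa [re_ofReal_add_mul_I]) ?_
    rw [im_ofReal_add_mul_I]
    exact mul_ne_zero hs0 (hτ.trans_le hT).ne'
  have i1 : IntegrableOn (fun x : ℝ => f (x + (s * τ : ℝ) * Complex.I)) (Iic σ) := by
    have hc : ContinuousOn (fun x : ℝ => f (x + (s * τ : ℝ) * Complex.I)) (Iic σ) := fun x hx =>
      (ContinuousAt.comp (g := f) (f := fun x : ℝ => (x : ℂ) + (s * τ : ℝ) * Complex.I)
        (df x τ hx le_rfl).continuousAt (by fun_prop)).continuousWithinAt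
    have he := (integrableOn_exp_mul_Iic one_pos σ).const_mul (C * Real.exp (-δ * τ))
    refine Integrable.mono' he (hc.aestronglyMeasurable measurableSet_Iic) ?_
    filter_upwards [ae_restrict_mem measurableSet_Iic] with x hx
    simpa using bd x τ hx le_rfl
  have i2 : IntegrableOn (fun y : ℝ => f (σ + (s * y : ℝ) * Complex.I)) (Ioi τ) := by
    have hc : ContinuousOn (fun y : ℝ => f (σ + (s * y : ℝ) * Complex.I)) (Ioi τ) := fun y hy =>
      (ContinuousAt.comp (g := f) (f := fun y : ℝ => (σ : ℂ) + (s * y : ℝ) * Complex.I)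
        (df σ y le_rfl (mem_Ioi.1 hy).le).continuousAt (by fun_prop)).continuousWithinAt
    have he := (integrableOn_exp_mul_Ioi (a := -δ) (by linarith) τ).const_mul (C * Real.exp σ)
    refine Integrable.mono' he (hc.aestronglyMeasurable measurableSet_Ioi) ?_
    filter_upwards [ae_restrict_mem measurableSet_Ioi] with y hy
    refine (bd σ y le_rfl (mem_Ioi.1 hy).le).trans_eq ?_
    ring
  refine ⟨i1, i2, ?_⟩
  have t1 := intervalIntegral_tendsto_integral_Iic σ i1 tendsto_neg_atTop_atBot
  have t2 := intervalIntegral_tendsto_integral_Ioi τ i2 tendsto_id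
  have e0 : Tendsto (fun N : ℝ => Real.exp (-δ * N)) atTop (𝓝 0) :=
    Real.tendsto_exp_atBot.comp (tendsto_id.const_mul_atTop_of_neg (by linarith))
  -- The far horizontal edge has length growing with `N`, but the factor `e^{Re u}` bounds its
  -- integral by `C e^{-δN} e^σ`.
  have t3 : Tendsto (fun N : ℝ => ∫ x in (-N)..σ, f (x + (s * N : ℝ) * Complex.I)) atTop
      (𝓝 0) := by
    have hz : Tendsto (fun N : ℝ => C * Real.exp (-δ * N) * Real.exp σ) atTop (𝓝 0) := by
      simpa using (e0.const_mul C).mul_const (Real.exp σ)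
    refine squeeze_zero_norm' ?_ hz
    filter_upwards [eventually_ge_atTop τ, eventually_ge_atTop (-σ)] with N hN hN'
    have hle : -N ≤ σ := by linarith
    rw [intervalIntegral.integral_of_le hle]
    have hi : IntegrableOn (fun x : ℝ => C * Real.exp (-δ * N) * Real.exp x) (Iic σ) := by
      simpa [IntegrableOn] using (integrableOn_exp_mul_Iic one_pos σ).const_mul (C * Real.exp (-δ * N))
    calc ‖∫ x in Ioc (-N) σ, f (x + (s * N : ℝ) * Complex.I)‖
        ≤ ∫ x in Ioc (-N) σ, C * Real.exp (-δ * N) * Real.exp x := by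
          refine norm_integral_le_of_norm_le (hi.mono_set Ioc_subset_Iic_self) ?_
          filter_upwards [ae_restrict_mem measurableSet_Ioc] with x hx
          exact bd x N hx.2 hN
      _ ≤ ∫ x in Iic σ, C * Real.exp (-δ * N) * Real.exp x := by
          refine setIntegral_mono_set hi (Eventually.of_forall fun x => ?_)
            (Ioc_subset_Iic_self.eventuallyLE)
          positivity
      _ = C * Real.exp (-δ * N) * Real.exp σ := by
          rw [integral_const_mul, integral_exp_Iic]
  have t4 : Tendsto (fun N : ℝ => ∫ y in τ..N, f ((-N : ℝ) + (s * y : ℝ) * Complex.I)) atTop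
      (𝓝 0) := by
    have hz : Tendsto (fun N : ℝ => Real.exp (-N) * (C * (Real.exp (-δ * τ) / δ))) atTop
        (𝓝 0) := by
      simpa using (Real.tendsto_exp_neg_atTop_nhds_zero).mul_const _
    refine squeeze_zero_norm' ?_ hz
    filter_upwards [eventually_ge_atTop τ, eventually_ge_atTop (-σ)] with N hN hN'
    rw [intervalIntegral.integral_of_le hN]
    have hi : IntegrableOn (fun y : ℝ => Real.exp (-N) * (C * Real.exp (-δ * y))) (Ioi τ) :=
      ((integrableOn_exp_mul_Ioi (a := -δ) (by linarith) τ).const_mul C).const_mul _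
    calc ‖∫ y in Ioc τ N, f ((-N : ℝ) + (s * y : ℝ) * Complex.I)‖
        ≤ ∫ y in Ioc τ N, Real.exp (-N) * (C * Real.exp (-δ * y)) := by
          refine norm_integral_le_of_norm_le (hi.mono_set Ioc_subset_Ioi_self) ?_
          filter_upwards [ae_restrict_mem measurableSet_Ioc] with y hy
          refine (bd (-N) y (by linarith) hy.1.le).trans_eq ?_
          ring
      _ ≤ ∫ y in Ioi τ, Real.exp (-N) * (C * Real.exp (-δ * y)) := by
          refine setIntegral_mono_set hi (Eventually.of_forall fun x => ?_)
            (Ioc_subset_Ioi_self.eventuallyLE)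
          positivity
      _ = Real.exp (-N) * (C * (Real.exp (-δ * τ) / δ)) := by
          rw [integral_const_mul, integral_const_mul, integral_exp_mul_Ioi (by linarith)]
          rw [neg_div_neg_eq]
  have key : ∀ᶠ N : ℝ in atTop, (∫ x in (-N)..σ, f (x + (s * τ : ℝ) * Complex.I)) -
      (∫ x in (-N)..σ, f (x + (s * N : ℝ) * Complex.I)) +
      Complex.I * (s * ∫ y in τ..N, f (σ + (s * y : ℝ) * Complex.I)) -
      Complex.I * (s * ∫ y in τ..N, f ((-N : ℝ) + (s * y : ℝ) * Complex.I)) = 0 := by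
    filter_upwards [eventually_ge_atTop τ, eventually_ge_atTop (-σ)] with N hN hN'
    have hle : -N ≤ σ := by linarith
    have := Complex.integral_boundary_rect_eq_zero_of_differentiableOn f
      ((-N : ℝ) + (s * τ : ℝ) * Complex.I) (σ + (s * N : ℝ) * Complex.I) (fun u hu => by
        rw [Complex.mem_reProdIm, re_ofReal_add_mul_I, re_ofReal_add_mul_I, uIcc_of_le hle, im_ofReal_add_mul_I,
          im_ofReal_add_mul_I] at hu
        refine (hf u hu.1.2 fun h0 => ?_).differentiableWithinAt
        have h2 := hu.2
        rw [h0] at h2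
        rcases hs with rfl | rfl
        · rw [one_mul, one_mul, uIcc_of_le hN] at h2
          exact absurd h2.1 (by linarith)
        · rw [uIcc_of_ge (by linarith)] at h2
          exact absurd h2.2 (by linarith))
    simp only [re_ofReal_add_mul_I, im_ofReal_add_mul_I, smul_eq_mul] at this
    have e1 : ∀ x : ℝ, (s : ℂ) * ∫ y in τ..N, f (x + (s * y : ℝ) * Complex.I) =
        ∫ y in (s * τ)..(s * N), f (x + y * Complex.I) := by
      intro x
      have := intervalIntegral.smul_integral_comp_mul_left (a := τ) (b := N)
        (fun y : ℝ => f (x + y * Complex.I)) s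
      rwa [Complex.real_smul] at this
    rw [e1, e1]
    exact this
  have lim := (((t1.sub t3).add ((t2.const_mul (s : ℂ)).const_mul Complex.I)).sub
    ((t4.const_mul (s : ℂ)).const_mul Complex.I))
  have l0 := tendsto_nhds_unique lim (tendsto_const_nhds.congr' (key.mono fun T h => h.symm))
  linear_combination l0

/-- The loop integral of a function that decays exponentially can be deformed into an integral along
a vertical line. -/
theorem loopIntegral_eq_vertical {f : ℂ → ℂ} {σ τ δ : ℝ} (hδ : 0 < δ) (hτ : 0 < τ)
    (hf : ∀ u : ℂ, u.re ≤ σ → u.im ≠ 0 → DifferentiableAt ℂ f u)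
    (hf' : ∀ u : ℂ, u.re = σ → DifferentiableAt ℂ f u)
    (hb : ∀ t, 0 < t → ∃ C, ∀ u : ℂ, u.re ≤ σ → t ≤ |u.im| →
      ‖f u‖ ≤ C * Real.exp (-δ * |u.im|) * Real.exp u.re) :
    LoopIntegrable f σ τ ∧
      loopIntegral f σ τ = (2 * (Real.pi : ℂ))⁻¹ * ∫ y : ℝ, f (σ + y * Complex.I) := by
  obtain ⟨C, hC⟩ := hb τ hτ
  obtain ⟨C', hC'⟩ := hb 1 one_pos
  obtain ⟨u1, u2, u3⟩ := integral_ray_eq_of_exp_decay (Or.inl rfl) hδ hτ hf hC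
  obtain ⟨l1, l2, l3⟩ := integral_ray_eq_of_exp_decay (Or.inr rfl) hδ hτ hf hC
  have iv : Integrable (fun y : ℝ => f (σ + y * Complex.I)) :=
    integrable_vertical (C := C' * Real.exp σ) hδ hf' fun u hu h1 => by
      refine (hC' u hu.le h1).trans_eq ?_
      rw [hu]
      ring
  have eu : ∀ x : ℝ, (x : ℂ) + (1 * τ : ℝ) * Complex.I = x + τ * Complex.I := by
    intro x; simp
  have el : ∀ x : ℝ, (x : ℂ) + (-1 * τ : ℝ) * Complex.I = x - τ * Complex.I := by
    intro x; push_cast; ring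
  simp only [eu] at u1 u3
  simp only [el] at l1 l3
  refine ⟨⟨l1, iv.intervalIntegrable, u1⟩, ?_⟩
  have r2 : ∫ y in Ioi τ, f (σ + (-1 * y : ℝ) * Complex.I) =
      ∫ y in Iic (-τ), f (σ + y * Complex.I) := by
    simp only [neg_one_mul]
    exact integral_comp_neg_Ioi τ (fun y : ℝ => f (σ + y * Complex.I))
  have r1 : ∫ y in Ioi τ, f (σ + (1 * y : ℝ) * Complex.I) =
      ∫ y in Ioi τ, f (σ + y * Complex.I) := by
    simp only [one_mul]
  -- The rotated rays are exactly the tails `y ≤ -τ` and `y > τ` missing from the vertical segment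
  -- of the loop.
  have split : ∫ y : ℝ, f (σ + y * Complex.I) = (∫ y in Iic (-τ), f (σ + y * Complex.I)) +
      (∫ y in (-τ)..τ, f (σ + y * Complex.I)) + ∫ y in Ioi τ, f (σ + y * Complex.I) := by
    rw [← intervalIntegral.integral_Iic_sub_Iic iv.integrableOn iv.integrableOn,
      ← intervalIntegral.integral_Iic_add_Ioi iv.integrableOn iv.integrableOn (b := τ)]
    ring
  rw [loopIntegral, u3, l3, r1, r2, split]
  have hI := Complex.I_ne_zero
  have hpi : (Real.pi : ℂ) ≠ 0 := by exact_mod_cast Real.pi_ne_zero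
  field_simp
  push_cast
  ring

/-! ### Growth estimates for the Gamma function and complex powers -/

theorem norm_Gamma_le_Gamma_re {v : ℂ} (hv : 0 < v.re) : ‖Complex.Gamma v‖ ≤ Real.Gamma v.re := by
  rw [Complex.Gamma_eq_integral hv, Real.Gamma_eq_integral hv, Complex.GammaIntegral]
  refine (norm_integral_le_integral_norm _).trans_eq ?_
  refine setIntegral_congr_fun measurableSet_Ioi fun x hx => ?_
  simp only [norm_mul, Complex.norm_real, Real.norm_eq_abs, Real.abs_exp,
    Complex.norm_cpow_eq_rpow_re_of_pos (mem_Ioi.1 hx), Complex.sub_re, Complex.one_re]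

/-- By reflection the product is `π / sin(πu)`, and `2 |sin(πu)| ≥ e^{π|Im u|} - e^{-π|Im u|}`. For
`|Im u| ≥ τ` the second exponential is at most `e^{-2πτ}` times the first. -/
theorem norm_Gamma_mul_Gamma_one_sub_le {τ : ℝ} (hτ : 0 < τ) :
    ∃ K, 0 ≤ K ∧ ∀ u : ℂ, τ ≤ |u.im| →
      ‖Complex.Gamma u * Complex.Gamma (1 - u)‖ ≤ K * Real.exp (-Real.pi * |u.im|) := by
  have hpi := Real.pi_pos
  have hlt : Real.exp (-2 * Real.pi * τ) < 1 := by
    rw [← Real.exp_zero]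
    exact Real.exp_lt_exp.2 (by nlinarith [mul_pos hpi hτ])
  refine ⟨2 * Real.pi / (1 - Real.exp (-2 * Real.pi * τ)), by
    apply div_nonneg <;> linarith, fun u hu => ?_⟩
  rw [Complex.Gamma_mul_Gamma_one_sub, norm_div]
  have hsin : (Real.exp (Real.pi * |u.im|) - Real.exp (-(Real.pi * |u.im|))) / 2 ≤
      ‖Complex.sin (Real.pi * u)‖ := by
    rw [Complex.sin, norm_div, norm_mul, Complex.norm_I, mul_one, Complex.norm_ofNat]
    have h1 : ‖Complex.exp (-(Real.pi * u) * Complex.I)‖ = Real.exp (Real.pi * u.im) := by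
      rw [Complex.norm_exp]; simp
    have h2 : ‖Complex.exp (Real.pi * u * Complex.I)‖ = Real.exp (-(Real.pi * u.im)) := by
      rw [Complex.norm_exp]; simp
    have h3 := abs_norm_sub_norm_le (Complex.exp (-(Real.pi * u) * Complex.I))
      (Complex.exp (Real.pi * u * Complex.I))
    rw [h1, h2] at h3
    have h4 : Real.exp (Real.pi * |u.im|) - Real.exp (-(Real.pi * |u.im|)) ≤
        |Real.exp (Real.pi * u.im) - Real.exp (-(Real.pi * u.im))| := by
      rcases abs_cases u.im with ⟨h, _⟩ | ⟨h, _⟩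
      · rw [h]; exact le_abs_self _
      · rw [h, mul_neg, neg_neg, abs_sub_comm]; exact le_abs_self _
    linarith
  have hE : Real.exp (-(Real.pi * |u.im|)) ≤
      Real.exp (-2 * Real.pi * τ) * Real.exp (Real.pi * |u.im|) := by
    rw [← Real.exp_add]
    exact Real.exp_le_exp.2 (by nlinarith)
  have hp := Real.exp_pos (Real.pi * |u.im|)
  have hpos : 0 < (1 - Real.exp (-2 * Real.pi * τ)) * Real.exp (Real.pi * |u.im|) / 2 := by
    have : 0 < 1 - Real.exp (-2 * Real.pi * τ) := by linarith
    positivity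
  have hle : (1 - Real.exp (-2 * Real.pi * τ)) * Real.exp (Real.pi * |u.im|) / 2 ≤
      ‖Complex.sin (Real.pi * u)‖ := by linarith
  rw [Complex.norm_real, Real.norm_eq_abs, abs_of_pos hpi]
  refine (div_le_div_of_nonneg_left hpi.le hpos hle).trans_eq ?_
  have : 1 - Real.exp (-2 * Real.pi * τ) ≠ 0 := by linarith
  rw [neg_mul Real.pi, Real.exp_neg (Real.pi * |u.im|)]
  field_simp

theorem Gamma_sub_nat_mul_prod (v : ℂ) (hv : v.im ≠ 0) (N : ℕ) :
    Complex.Gamma (v - N) * ∏ k ∈ Finset.range N, (v - (k + 1 : ℕ)) = Complex.Gamma v := by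
  induction N with
  | zero => simp
  | succ N ih =>
    rw [Finset.prod_range_succ, ← ih]
    have h : v - (N + 1 : ℕ) ≠ 0 := fun h => hv (by simpa using congrArg Complex.im h)
    have := Complex.Gamma_add_one _ h
    rw [show v - ((N + 1 : ℕ) : ℂ) + 1 = v - N by push_cast; ring] at this
    rw [this]
    ring

/-- Away from the real axis the Gamma function decays to the left faster than any exponential. -/
theorem norm_Gamma_le_exp {τ : ℝ} (hτ : 0 < τ) (S R : ℝ) :
    ∃ K, 0 ≤ K ∧ ∀ v : ℂ, v.re ≤ S → τ ≤ |v.im| → ‖Complex.Gamma v‖ ≤ K * Real.exp (R * v.re) := by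
  obtain ⟨m, hm⟩ := exists_nat_ge (max S 1)
  have hmS : S ≤ m := (le_max_left _ _).trans hm
  have hm1 : (1 : ℝ) ≤ m := (le_max_right _ _).trans hm
  obtain ⟨G, hG⟩ := isCompact_Icc.exists_bound_of_continuousOn (f := Real.Gamma)
    (s := Icc (m : ℝ) (m + 1)) (fun x hx => (Real.differentiableAt_Gamma fun k h => by
      have := hx.1
      have hk : (0 : ℝ) ≤ k := k.cast_nonneg
      linarith).continuousAt.continuousWithinAt)
  have hG0 : 0 ≤ G := (norm_nonneg _).trans (hG m (by simp))
  -- Chosen so that `|w - r| ≥ ε r` for each integer `r ≥ 1` when `Re w ≤ m + 1` and `|Im w| ≥ τ`: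
  -- the real part gives `r / 2` if `r ≥ 2(m + 1)`, and otherwise the imaginary part gives `τ`.
  set ε : ℝ := min (1 / 2) (τ / (2 * (m + 1))) with hε
  have hε0 : 0 < ε := by positivity
  set c : ℝ := Real.exp R / ε
  have hc0 : 0 ≤ c := by positivity
  -- With `c = e^R / ε`, boundedness of `c^N / N!` reads `1 / (ε^N N!) ≤ B e^{-RN}`: the factorial
  -- absorbs any exponential rate `R`.
  obtain ⟨B, hB⟩ := (FloorSemiring.tendsto_pow_div_factorial_atTop c).bddAbove_range
  have hB' : ∀ N : ℕ, c ^ N / N.factorial ≤ B := fun N => hB ⟨N, rfl⟩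
  have hB0 : 0 ≤ B := le_trans (by positivity) (hB' 0)
  obtain ⟨E, hE⟩ := isCompact_Icc.exists_bound_of_continuousOn
    (f := fun x : ℝ => Real.exp (-(R * x))) (s := Icc (m : ℝ) (m + 1)) (by fun_prop)
  have hE0 : 0 ≤ E := (norm_nonneg _).trans (hE m (by simp))
  refine ⟨G * B * E, by positivity, fun v hv hvi => ?_⟩
  -- The shift moves `v` into the strip `m ≤ Re w ≤ m + 1`, where `Γ` is bounded by its values on a
  -- real compact interval.
  set N := ⌈m - v.re⌉₊ with hN
  have hN1 : (m : ℝ) - v.re ≤ N := Nat.le_ceil _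
  have hN2 : (N : ℝ) < m - v.re + 1 := Nat.ceil_lt_add_one (by linarith)
  set w : ℂ := v + N with hw
  have hwr : w.re = v.re + N := by simp [hw]
  have hwi : w.im = v.im := by simp [hw]
  have hwm : w.re ∈ Icc (m : ℝ) (m + 1) := by rw [hwr]; constructor <;> linarith
  have hvi0 : w.im ≠ 0 := by
    rw [hwi]; intro h; rw [h, abs_zero] at hvi; linarith
  have hfac := Gamma_sub_nat_mul_prod w hvi0 N
  rw [show w - N = v by simp [hw]] at hfac
  have hlow : ∀ k : ℕ, ε * (k + 1 : ℕ) ≤ ‖w - (k + 1 : ℕ)‖ := by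
    intro k
    set r : ℝ := ((k + 1 : ℕ) : ℝ) with hr
    have hr0 : 0 < r := by positivity
    rcases le_total (2 * (m + 1 : ℝ)) r with h | h
    · have h1 := Complex.abs_re_le_norm (w - (k + 1 : ℕ))
      have h2 : (w - (k + 1 : ℕ)).re = w.re - r := by
        rw [Complex.sub_re, Complex.natCast_re]
      rw [h2] at h1
      have h3 := neg_abs_le (w.re - r)
      have h4 := hwm.2
      have h5 : ε * r ≤ 1 / 2 * r := mul_le_mul_of_nonneg_right (min_le_left _ _) hr0.le
      linarith
    · have h1 := Complex.abs_im_le_norm (w - (k + 1 : ℕ))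
      have h2 : (w - (k + 1 : ℕ)).im = v.im := by
        rw [Complex.sub_im, Complex.natCast_im, sub_zero, hwi]
      rw [h2] at h1
      have h5 : ε * r ≤ τ / (2 * (m + 1)) * r :=
        mul_le_mul_of_nonneg_right (min_le_right _ _) hr0.le
      have h6 : τ / (2 * (m + 1)) * r ≤ τ / (2 * (m + 1)) * (2 * (m + 1)) :=
        mul_le_mul_of_nonneg_left h (by positivity)
      rw [div_mul_cancel₀ _ (by positivity)] at h6
      linarith
  have hprod : ε ^ N * N.factorial ≤ ‖∏ k ∈ Finset.range N, (w - (k + 1 : ℕ))‖ := by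
    rw [norm_prod, ← Finset.prod_range_add_one_eq_factorial]
    push_cast
    rw [← Finset.card_range N, ← Finset.prod_const, Finset.card_range,
      ← Finset.prod_mul_distrib]
    refine Finset.prod_le_prod (fun k _ => by positivity) fun k _ => ?_
    exact_mod_cast hlow k
  have hpp : 0 < ε ^ N * (N.factorial : ℝ) := by positivity
  have hGw : ‖Complex.Gamma w‖ ≤ G :=
    (norm_Gamma_le_Gamma_re (by linarith [hwm.1])).trans ((le_abs_self _).trans (hG _ hwm))
  have h1 : ‖Complex.Gamma v‖ * (ε ^ N * N.factorial) ≤ G := by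
    refine le_trans (mul_le_mul_of_nonneg_left hprod (norm_nonneg _)) ?_
    rw [← norm_mul, hfac]
    exact hGw
  have h2 : ‖Complex.Gamma v‖ ≤ G / (ε ^ N * N.factorial) := (le_div_iff₀ hpp).2 h1
  have h3 : 1 / (ε ^ N * N.factorial) ≤ B * Real.exp (-(R * N)) := by
    have := hB' N
    rw [div_pow, ← Real.exp_nat_mul] at this
    rw [Real.exp_neg, ← div_eq_mul_inv, le_div_iff₀ (Real.exp_pos _)]
    refine le_trans (le_of_eq ?_) this
    rw [mul_comm R]
    field_simp
  have h4 : Real.exp (-(R * N)) ≤ E * Real.exp (R * v.re) := by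
    have h5 : Real.exp (-(R * N)) = Real.exp (-(R * w.re)) * Real.exp (R * v.re) := by
      rw [← Real.exp_add, hwr]; ring_nf
    rw [h5]
    refine mul_le_mul_of_nonneg_right ?_ (Real.exp_pos _).le
    exact (le_abs_self _).trans (hE _ hwm)
  calc ‖Complex.Gamma v‖ ≤ G * (1 / (ε ^ N * N.factorial)) := by rwa [mul_one_div]
    _ ≤ G * (B * (E * Real.exp (R * v.re))) := by gcongr; exact h3.trans (by gcongr)
    _ = G * B * E * Real.exp (R * v.re) := by ring

theorem norm_cpow_neg_le {z : ℂ} (hz : z ≠ 0) (u : ℂ) :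
    ‖z ^ (-u)‖ ≤ Real.exp (-Real.log ‖z‖ * u.re) * Real.exp (|z.arg| * |u.im|) := by
  rw [Complex.norm_cpow_of_ne_zero hz, Real.rpow_def_of_pos (norm_pos_iff.2 hz), div_eq_mul_inv,
    ← Real.exp_neg, Complex.neg_re, Complex.neg_im, mul_neg, mul_neg, neg_neg, neg_mul]
  refine mul_le_mul_of_nonneg_left (Real.exp_le_exp.2 ?_) (Real.exp_pos _).le
  rw [← abs_mul]
  exact le_abs_self _

theorem abs_arg_lt_pi {z : ℂ} (hz : z ∈ Complex.slitPlane) : |z.arg| < Real.pi := by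
  refine lt_of_le_of_ne (Complex.abs_arg_le_pi z) fun h => ?_
  rcases (abs_eq Real.pi_pos.le).1 h with h | h
  · exact (Complex.mem_slitPlane_iff_arg.1 hz).1 h
  · exact (Complex.neg_pi_lt_arg z).ne' h

theorem norm_natCast_sub_div_le {τ : ℝ} (hτ : 0 < τ) (k β : ℝ) {u : ℂ} (hu : τ ≤ |u.im|) :
    ‖(k - u) / (β + u)‖ ≤ 1 + |k + β| / τ := by
  have h1 : τ ≤ ‖(β : ℂ) + u‖ := by
    refine (hu.trans_eq ?_).trans (Complex.abs_im_le_norm _)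
    simp
  have h2 : 0 < ‖(β : ℂ) + u‖ := hτ.trans_le h1
  rw [norm_div, div_le_iff₀ h2]
  have h3 : (k : ℂ) - u = ((k + β : ℝ) : ℂ) - (β + u) := by push_cast; ring
  have h4 : ‖(k : ℂ) - u‖ ≤ |k + β| + ‖(β : ℂ) + u‖ := by
    rw [h3]
    refine (norm_sub_le _ _).trans_eq ?_
    rw [Complex.norm_real, Real.norm_eq_abs]
  have h5 : |k + β| ≤ |k + β| / τ * ‖(β : ℂ) + u‖ := by
    rw [div_mul_eq_mul_div, le_div_iff₀ hτ]
    gcongr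
  linarith

theorem Gamma_add_natCast (s : ℂ) (N : ℕ) (hs : ∀ k < N, s + (k : ℕ) ≠ 0) :
    Complex.Gamma (s + N) = (∏ k ∈ Finset.range N, (s + k)) * Complex.Gamma s := by
  induction N with
  | zero => simp
  | succ N ih =>
    rw [Finset.prod_range_succ, Nat.cast_succ, ← add_assoc,
      Complex.Gamma_add_one _ (hs N N.lt_succ_self), ih fun k hk => hs k (hk.trans N.lt_succ_self)]
    ring

/-! ### The Meijer integrand and its admissible loops -/

theorem meijerIntegrand_eq_Gamma (a b : ℝ) (n : ℕ) (z u : ℂ) :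
    meijerIntegrand 3 1 ![-(n : ℂ), ((a + b : ℝ) : ℂ) + n + 1] ![0, ((a + b : ℝ) : ℂ), (b : ℂ)] z u =
      Complex.Gamma u * Complex.Gamma ((a + b : ℝ) + u) * Complex.Gamma (b + u) *
        (Complex.Gamma (n + 1 - u) * (Complex.Gamma ((a + b : ℝ) + n + 1 + u))⁻¹) * z ^ (-u) := by
  simp only [meijerIntegrand, Fin.prod_univ_three, Fin.prod_univ_two]
  simp [show (1 : ℂ) + n - u = n + 1 - u by ring]

/-- The rational function `(1 - u)_n / (α + u)_{n+1}`. -/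
def cauchyLaguerreRatio (α : ℝ) (n : ℕ) (u : ℂ) : ℂ :=
  (∏ k ∈ Finset.range n, ((k : ℂ) + 1 - u)) / ∏ k ∈ Finset.range (n + 1), ((α : ℂ) + u + k)

/-- This form separates the roles of the factors: vertical decay from `Γ(u) Γ(1 - u)`, a rational
factor bounded away from the real axis, and decay to the left from `Γ(b + u)`. It is also the form
in which the moments of `p_n` produce the integrand. The hypotheses keep the arguments clear of the
zeros that would break the functional equation. -/
theorem meijerIntegrand_eq_ratio (a b : ℝ) (n : ℕ) (z u : ℂ)
    (h1 : ∀ k < n, 1 - u + (k : ℕ) ≠ 0) (h2 : ∀ k : ℕ, ((a + b : ℝ) : ℂ) + u + k ≠ 0) :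
    meijerIntegrand 3 1 ![-(n : ℂ), ((a + b : ℝ) : ℂ) + n + 1] ![0, ((a + b : ℝ) : ℂ), (b : ℂ)] z u =
      Complex.Gamma u * Complex.Gamma (1 - u) * cauchyLaguerreRatio (a + b) n u *
        Complex.Gamma (b + u) * z ^ (-u) := by
  rw [meijerIntegrand_eq_Gamma, cauchyLaguerreRatio]
  have e1 := Gamma_add_natCast (1 - u) n h1
  have e2 := Gamma_add_natCast ((a + b : ℝ) + u) (n + 1) fun k _ => h2 k
  rw [show 1 - u + n = n + 1 - u by ring] at e1
  rw [show ((a + b : ℝ) : ℂ) + u + ((n + 1 : ℕ) : ℂ) = (a + b : ℝ) + n + 1 + u by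
    push_cast; ring] at e2
  have hG : Complex.Gamma ((a + b : ℝ) + u) ≠ 0 := Complex.Gamma_ne_zero fun m h =>
    h2 m (by rw [h]; ring)
  have hP : ∏ k ∈ Finset.range (n + 1), (((a + b : ℝ) : ℂ) + u + k) ≠ 0 :=
    Finset.prod_ne_zero_iff.2 fun k _ => h2 k
  rw [e1, e2, Finset.prod_congr rfl fun (k : ℕ) _ => show 1 - u + (k : ℂ) = k + 1 - u by ring]
  field_simp

/-- Each of the `n` numerator factors is paired with one denominator factor, giving a bounded
quotient; the unpaired denominator factor has modulus at least `τ`. -/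
theorem norm_cauchyLaguerreRatio_le (α : ℝ) (n : ℕ) {τ : ℝ} (hτ : 0 < τ) :
    ∃ K, 0 ≤ K ∧ ∀ u : ℂ, τ ≤ |u.im| → ‖cauchyLaguerreRatio α n u‖ ≤ K := by
  refine ⟨(∏ k ∈ Finset.range n, (1 + |((k : ℝ) + 1) + (α + k)| / τ)) * (1 / τ), by positivity,
    fun u hu => ?_⟩
  rw [cauchyLaguerreRatio, Finset.prod_range_succ, ← div_div, ← Finset.prod_div_distrib,
    div_eq_mul_one_div, norm_mul, norm_prod]
  gcongr with k hk
  · have := norm_natCast_sub_div_le hτ ((k : ℝ) + 1) (α + k) hu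
    push_cast at this
    rwa [show (α : ℂ) + u + k = α + k + u by ring]
  · rw [norm_div, norm_one]
    refine one_div_le_one_div_of_le hτ ((hu.trans_eq ?_).trans (Complex.abs_im_le_norm _))
    simp

theorem differentiableAt_meijerIntegrand (a b : ℝ) (n : ℕ) {z u : ℂ} (hz : z ≠ 0)
    (hu : u.im ≠ 0 ∨ 0 < u.re ∧ 0 < a + b + u.re ∧ 0 < b + u.re ∧ u.re < n + 1) :
    DifferentiableAt ℂ (meijerIntegrand 3 1 ![-(n : ℂ), ((a + b : ℝ) : ℂ) + n + 1]
      ![0, ((a + b : ℝ) : ℂ), (b : ℂ)] z) u := by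
  rw [show meijerIntegrand 3 1 ![-(n : ℂ), ((a + b : ℝ) : ℂ) + n + 1]
      ![0, ((a + b : ℝ) : ℂ), (b : ℂ)] z = _ from funext (meijerIntegrand_eq_Gamma a b n z)]
  have hG : ∀ c : ℝ, (u.im = 0 → 0 < c + u.re) →
      DifferentiableAt ℂ (fun u => Complex.Gamma (c + u)) u := by
    intro c hc
    refine DifferentiableAt.comp (g := Complex.Gamma) u
      (Complex.differentiableAt_Gamma _ fun m hm => ?_) (by fun_prop)
    have h1 := congrArg Complex.im hm
    have h2 := congrArg Complex.re hm
    simp at h1 h2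
    have := hc h1
    have : (0 : ℝ) ≤ m := m.cast_nonneg
    linarith
  have g0 : DifferentiableAt ℂ Complex.Gamma u := by
    simpa using hG 0 fun h => by rcases hu with hu | hu; exacts [absurd h hu, by linarith]
  have g1 := hG (a + b) fun h => by rcases hu with hu | hu; exacts [absurd h hu, by linarith]
  have g2 := hG b fun h => by rcases hu with hu | hu; exacts [absurd h hu, by linarith]
  have g3 : DifferentiableAt ℂ (fun u => Complex.Gamma (n + 1 - u)) u := by
    refine DifferentiableAt.comp (g := Complex.Gamma) u
      (Complex.differentiableAt_Gamma _ fun m hm => ?_) (by fun_prop)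
    have h1 := congrArg Complex.im hm
    have h2 := congrArg Complex.re hm
    simp at h1 h2
    rcases hu with hu | hu
    · exact hu h1
    · have : (0 : ℝ) ≤ m := m.cast_nonneg
      linarith
  have g4 : DifferentiableAt ℂ (fun u => (Complex.Gamma ((a + b : ℝ) + n + 1 + u))⁻¹) u :=
    (Complex.differentiable_one_div_Gamma _).comp u (by fun_prop)
  have g5 : DifferentiableAt ℂ (fun u => z ^ (-u)) u :=
    DifferentiableAt.const_cpow (by fun_prop) (Or.inl hz)
  exact (((g0.mul g1).mul g2).mul (g3.mul g4)).mul g5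

theorem norm_meijerIntegrand_le (a b : ℝ) (n : ℕ) {z : ℂ} (hz : z ≠ 0) (σ : ℝ) {τ : ℝ}
    (hτ : 0 < τ) :
    ∃ C, ∀ u : ℂ, u.re ≤ σ → τ ≤ |u.im| →
      ‖meijerIntegrand 3 1 ![-(n : ℂ), ((a + b : ℝ) : ℂ) + n + 1]
        ![0, ((a + b : ℝ) : ℂ), (b : ℂ)] z u‖ ≤
        C * Real.exp (-(Real.pi - |z.arg|) * |u.im|) * Real.exp u.re := by
  obtain ⟨K1, h1, H1⟩ := norm_Gamma_mul_Gamma_one_sub_le hτ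
  obtain ⟨K2, h2, H2⟩ := norm_cauchyLaguerreRatio_le (a + b) n hτ
  -- The rate `1 + log ‖z‖` cancels the factor `e^{-log ‖z‖ Re u}` of `z^{-u}` and leaves `e^{Re
  -- u}`.
  obtain ⟨K3, h3, H3⟩ := norm_Gamma_le_exp hτ (b + σ) (1 + Real.log ‖z‖)
  refine ⟨K1 * K2 * K3 * Real.exp ((1 + Real.log ‖z‖) * b), fun u hu hui => ?_⟩
  have him : u.im ≠ 0 := fun h => by rw [h, abs_zero] at hui; linarith
  rw [meijerIntegrand_eq_ratio a b n z u
    (fun k _ h => him (by simpa using congrArg Complex.im h))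
    (fun k h => him (by simpa using congrArg Complex.im h)), norm_mul, norm_mul, norm_mul]
  have H3' := H3 (b + u) (by simpa using hu) (by simpa using hui)
  rw [Complex.add_re, Complex.ofReal_re] at H3'
  calc _ ≤ (K1 * Real.exp (-Real.pi * |u.im|)) * K2 *
        (K3 * Real.exp ((1 + Real.log ‖z‖) * (b + u.re))) *
        (Real.exp (-Real.log ‖z‖ * u.re) * Real.exp (|z.arg| * |u.im|)) := by
        gcongr
        · exact H1 u hui
        · exact H2 u hui
        · exact norm_cpow_neg_le hz u
    _ = K1 * K2 * K3 * (Real.exp (-Real.pi * |u.im|) * Real.exp ((1 + Real.log ‖z‖) * (b + u.re)) *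
        Real.exp (-Real.log ‖z‖ * u.re) * Real.exp (|z.arg| * |u.im|)) := by ring
    _ = _ := by
      rw [mul_assoc (K1 * K2 * K3), mul_assoc (K1 * K2 * K3)]
      congr 1
      simp only [← Real.exp_add]
      congr 1
      ring

/-- All parameters are real, so only the real parts matter, and in each family the pole with `k = 0`
is the binding one. -/
theorem isMeijerLoop_iff (a b : ℝ) (n : ℕ) (σ τ : ℝ) :
    IsMeijerLoop 3 1 ![-(n : ℂ), ((a + b : ℝ) : ℂ) + n + 1] ![0, ((a + b : ℝ) : ℂ), (b : ℂ)] σ τ ↔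
      0 < τ ∧ 0 < σ ∧ 0 < a + b + σ ∧ 0 < b + σ ∧ σ < n + 1 := by
  constructor
  · rintro ⟨h0, h1, h2⟩
    have i0 := (h1 0 (by simp) 0).1
    have i1 := (h1 1 (by simp) 0).1
    have i2 := (h1 2 (by simp) 0).1
    have o0 := h2 0 (by simp) 0
    simp at i0 i1 i2 o0
    refine ⟨h0, i0, by linarith, by linarith, ?_⟩
    rcases o0 with h | h <;> linarith
  · rintro ⟨h0, h1, h2, h3, h4⟩
    refine ⟨h0, fun j _ k => ?_, fun j hj k => Or.inl ?_⟩
    · have : (0 : ℝ) ≤ k := k.cast_nonneg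
      fin_cases j <;> simp [h0] <;> linarith
    · have : (0 : ℝ) ≤ k := k.cast_nonneg
      fin_cases j
      · simp; linarith
      · simp at hj

/-- The Meijer function of the theorem as an integral along a vertical line in the strip where the
Gamma factors reduce to `π / sin (π u)`. -/
theorem hasMeijerG_vertical {a b c : ℝ} (n : ℕ) {z : ℂ} (hz : z ∈ Complex.slitPlane)
    (hc0 : 0 < c) (hc1 : c < 1) (hca : 0 < a + b + c) (hcb : 0 < b + c) :
    HasMeijerG 3 1 ![-(n : ℂ), ((a + b : ℝ) : ℂ) + n + 1] ![0, ((a + b : ℝ) : ℂ), (b : ℂ)] z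
      ((2 * (Real.pi : ℂ))⁻¹ * ∫ y : ℝ, meijerIntegrand 3 1 ![-(n : ℂ), ((a + b : ℝ) : ℂ) + n + 1]
        ![0, ((a + b : ℝ) : ℂ), (b : ℂ)] z (c + y * Complex.I)) := by
  have hz0 := Complex.slitPlane_ne_zero hz
  have hδ : 0 < Real.pi - |z.arg| := sub_pos.2 (abs_arg_lt_pi hz)
  have hn : (0 : ℝ) ≤ n := n.cast_nonneg
  set f := meijerIntegrand 3 1 ![-(n : ℂ), ((a + b : ℝ) : ℂ) + n + 1]
    ![0, ((a + b : ℝ) : ℂ), (b : ℂ)] z with hf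
  -- The strip between the two families of poles is pole-free, so the vertical integral through any
  -- admissible `σ` equals the one through `c`.
  have shift : ∀ c₁ c₂ : ℝ, 0 < c₁ → 0 < a + b + c₁ → 0 < b + c₁ → c₁ ≤ c₂ → c₂ < n + 1 →
      ∫ y : ℝ, f (c₁ + y * Complex.I) = ∫ y : ℝ, f (c₂ + y * Complex.I) := by
    intro c₁ c₂ h0 h1 h2 h3 h4
    obtain ⟨C, hC⟩ := norm_meijerIntegrand_le a b n hz0 c₂ one_pos
    have hC0 : 0 ≤ C := by
      have := (norm_nonneg _).trans (hC (c₂ + (1 : ℝ) * Complex.I) (by simp) (by simp))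
      rw [mul_assoc] at this
      exact nonneg_of_mul_nonneg_left this (by positivity)
    refine integral_vertical_eq_of_exp_decay (C := C * Real.exp c₂) h3 hδ
      (fun u hu1 hu2 => differentiableAt_meijerIntegrand a b n hz0
        (Or.inr ⟨by linarith, by linarith, by linarith, by linarith⟩)) fun u hu1 hu2 hu3 => ?_
    refine (hC u hu2 hu3).trans ?_
    rw [mul_right_comm]
    gcongr
  refine ⟨⟨c, 1, (isMeijerLoop_iff a b n c 1).2 ⟨one_pos, hc0, hca, hcb, by linarith⟩⟩,
    fun σ τ h => ?_⟩
  obtain ⟨h0, h1, h2, h3, h4⟩ := (isMeijerLoop_iff a b n σ τ).1 h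
  obtain ⟨k1, k2⟩ := loopIntegral_eq_vertical (f := f) (σ := σ) hδ h0
    (fun u _ hu => differentiableAt_meijerIntegrand a b n hz0 (Or.inl hu))
    (fun u hu => differentiableAt_meijerIntegrand a b n hz0
      (Or.inr ⟨by linarith, by linarith, by linarith, by linarith⟩))
    (fun t ht => norm_meijerIntegrand_le a b n hz0 σ ht)
  refine ⟨k1, k2.trans ?_⟩
  rcases le_total c σ with h | h
  · rw [shift c σ hc0 hca hcb h h4]
  · rw [shift σ c h1 h2 h3 h (by linarith)]

/-! ### The Mellin–Barnes integral of `1 / (1 + w)` -/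

theorem differentiableAt_Gamma_mul_Gamma_one_sub {u : ℂ} (h0 : 0 < u.re) (h1 : u.re < 1) :
    DifferentiableAt ℂ (fun u => Complex.Gamma u * Complex.Gamma (1 - u)) u := by
  have hG : ∀ s : ℂ, 0 < s.re → DifferentiableAt ℂ Complex.Gamma s := fun s hs =>
    Complex.differentiableAt_Gamma _ fun m hm => by
      have h2 := congrArg Complex.re hm
      have : (0 : ℝ) ≤ m := m.cast_nonneg
      simp at h2
      linarith
  exact (hG u h0).mul (DifferentiableAt.comp (g := Complex.Gamma) u
    (hG _ (by simpa using h1)) (by fun_prop))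

theorem integral_pi_div_cosh : ∫ y : ℝ, Real.pi / Real.cosh (Real.pi * y) = Real.pi := by
  have hd : ∀ y : ℝ, HasDerivAt (fun y => Real.arctan (Real.sinh (Real.pi * y)))
      (Real.pi / Real.cosh (Real.pi * y)) y := by
    intro y
    have h1 : HasDerivAt (fun y : ℝ => Real.pi * y) Real.pi y := by
      simpa using (hasDerivAt_id y).const_mul Real.pi
    have h := (h1.sinh).arctan
    convert h using 1
    have hc := Real.cosh_pos (Real.pi * y)
    have := Real.cosh_sq (Real.pi * y)
    rw [show 1 + Real.sinh (Real.pi * y) ^ 2 = Real.cosh (Real.pi * y) ^ 2 by linarith]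
    field_simp
  have ht : Tendsto (fun y => Real.arctan (Real.sinh (Real.pi * y))) atTop (𝓝 (Real.pi / 2)) :=
    (tendsto_nhds_of_tendsto_nhdsWithin Real.tendsto_arctan_atTop).comp
      ((Real.sinhOrderIso.tendsto_atTop).comp (tendsto_id.const_mul_atTop Real.pi_pos))
  have hb : Tendsto (fun y => Real.arctan (Real.sinh (Real.pi * y))) atBot (𝓝 (-(Real.pi / 2))) :=
    (tendsto_nhds_of_tendsto_nhdsWithin Real.tendsto_arctan_atBot).comp
      ((Real.sinhOrderIso.tendsto_atBot).comp (tendsto_id.const_mul_atBot Real.pi_pos))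
  have hi : Integrable (fun y : ℝ => Real.pi / Real.cosh (Real.pi * y)) := by
    refine ((integrable_exp_neg_mul_abs Real.pi_pos).const_mul (2 * Real.pi)).mono'
      (Continuous.aestronglyMeasurable ?_) (Eventually.of_forall fun y => ?_)
    · exact continuous_const.div (by fun_prop) fun y => (Real.cosh_pos _).ne'
    · have hp := Real.pi_pos
      have hc := Real.cosh_pos (Real.pi * y)
      rw [Real.norm_eq_abs, abs_of_pos (div_pos hp hc), div_le_iff₀ hc, ← Real.cosh_abs, abs_mul,
        abs_of_pos hp, Real.cosh_eq, neg_mul]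
      have e1 : Real.exp (-(Real.pi * |y|)) * Real.exp (Real.pi * |y|) = 1 := by
        rw [← Real.exp_add]; simp
      nlinarith [mul_pos (Real.exp_pos (-(Real.pi * |y|))) (Real.exp_pos (-(Real.pi * |y|)))]
  rw [integral_of_hasDerivAt_of_tendsto hd hi hb ht]
  ring

/-- On `Re u = 1/2` the integrand is `π / cosh(πy)`, with antiderivative `arctan(sinh(πy))`; other
lines in the strip follow by shifting. -/
theorem integral_Gamma_mul_Gamma_one_sub {c : ℝ} (h0 : 0 < c) (h1 : c < 1) :
    ∫ y : ℝ, Complex.Gamma (c + y * Complex.I) * Complex.Gamma (1 - (c + y * Complex.I)) =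
      Real.pi := by
  obtain ⟨K, -, hK⟩ := norm_Gamma_mul_Gamma_one_sub_le one_pos
  have shift : ∀ c₁ c₂ : ℝ, 0 < c₁ → c₂ < 1 → c₁ ≤ c₂ →
      ∫ y : ℝ, Complex.Gamma (c₁ + y * Complex.I) * Complex.Gamma (1 - (c₁ + y * Complex.I)) =
      ∫ y : ℝ, Complex.Gamma (c₂ + y * Complex.I) * Complex.Gamma (1 - (c₂ + y * Complex.I)) :=
    fun c₁ c₂ h0 h1 h => integral_vertical_eq_of_exp_decay
      (f := fun u => Complex.Gamma u * Complex.Gamma (1 - u)) h Real.pi_pos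
      (fun u hu1 hu2 => differentiableAt_Gamma_mul_Gamma_one_sub (by linarith) (by linarith))
      (fun u _ _ hu => hK u hu)
  have half : ∫ y : ℝ, Complex.Gamma ((1 / 2 : ℝ) + y * Complex.I) *
      Complex.Gamma (1 - ((1 / 2 : ℝ) + y * Complex.I)) = Real.pi := by
    have hh : ∫ y : ℝ, ((Real.pi / Real.cosh (Real.pi * y) : ℝ) : ℂ) = Real.pi := by
      rw [integral_complex_ofReal, integral_pi_div_cosh]
    rw [← hh]
    refine integral_congr_ae (Eventually.of_forall fun y => ?_)
    simp only
    rw [Complex.Gamma_mul_Gamma_one_sub]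
    push_cast
    rw [show (Real.pi : ℂ) * (1 / 2 + y * Complex.I) = Real.pi * y * Complex.I + Real.pi / 2 by
      ring, Complex.sin_add_pi_div_two, Complex.cos_mul_I]
  rw [← half]
  rcases le_total c (1 / 2) with h | h
  · exact shift c (1 / 2) h0 (by norm_num) h
  · exact (shift (1 / 2) c (by norm_num) h1 h).symm

theorem norm_Gamma_mul_Gamma_one_sub_mul_cpow_le {w : ℂ} (hw : w ≠ 0) (c : ℝ) :
    ∃ C, 0 ≤ C ∧ ∀ u : ℂ, |u.re| ≤ c → 1 ≤ |u.im| →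
      ‖Complex.Gamma u * Complex.Gamma (1 - u) * w ^ (-u)‖ ≤
        C * Real.exp (-(Real.pi - |w.arg|) * |u.im|) := by
  obtain ⟨K, hK0, hK⟩ := norm_Gamma_mul_Gamma_one_sub_le one_pos
  refine ⟨K * Real.exp (|Real.log ‖w‖| * c), by positivity, fun u hu h1 => ?_⟩
  rw [norm_mul]
  calc _ ≤ K * Real.exp (-Real.pi * |u.im|) *
        (Real.exp (|Real.log ‖w‖| * c) * Real.exp (|w.arg| * |u.im|)) := by
        refine mul_le_mul (hK u h1) ((norm_cpow_neg_le hw u).trans ?_) (norm_nonneg _)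
          (by positivity)
        refine mul_le_mul_of_nonneg_right (Real.exp_le_exp.2 ?_) (Real.exp_pos _).le
        calc -Real.log ‖w‖ * u.re ≤ |-Real.log ‖w‖ * u.re| := le_abs_self _
          _ = |Real.log ‖w‖| * |u.re| := by rw [abs_mul, abs_neg]
          _ ≤ _ := by gcongr
    _ = K * Real.exp (|Real.log ‖w‖| * c) *
        (Real.exp (-Real.pi * |u.im|) * Real.exp (|w.arg| * |u.im|)) := by ring
    _ = _ := by
      rw [← Real.exp_add]
      congr 2
      ring

theorem integrable_Gamma_mul_Gamma_one_sub_mul_cpow {c : ℝ} (h0 : 0 < c) (h1 : c < 1) {w : ℂ}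
    (hw : w ∈ Complex.slitPlane) :
    Integrable fun y : ℝ => Complex.Gamma (c + y * Complex.I) *
      Complex.Gamma (1 - (c + y * Complex.I)) * w ^ (-(c + y * Complex.I)) := by
  have hw0 := Complex.slitPlane_ne_zero hw
  obtain ⟨C, -, hC⟩ := norm_Gamma_mul_Gamma_one_sub_mul_cpow_le hw0 c
  refine integrable_vertical (f := fun u => Complex.Gamma u * Complex.Gamma (1 - u) * w ^ (-u))
    (sub_pos.2 (abs_arg_lt_pi hw)) (fun u hu => ?_) (fun u hu h => hC u ?_ h)
  · exact (differentiableAt_Gamma_mul_Gamma_one_sub (by linarith) (by linarith)).mul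
      (DifferentiableAt.const_cpow (by fun_prop) (Or.inl hw0))
  · rw [hu, abs_of_pos h0]

/-- The Mellin-Barnes integral of `1 / (1 + w)`. -/
theorem integral_Gamma_mul_Gamma_one_sub_mul_cpow {c : ℝ} (h0 : 0 < c) (h1 : c < 1) {w : ℂ}
    (hw : w ∈ Complex.slitPlane) :
    ∫ y : ℝ, Complex.Gamma (c + y * Complex.I) * Complex.Gamma (1 - (c + y * Complex.I)) *
      w ^ (-(c + y * Complex.I)) = 2 * Real.pi / (1 + w) := by
  have hw0 := Complex.slitPlane_ne_zero hw
  have hw1 : 1 + w ≠ 0 := fun h => by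
    rw [show w = ((-1 : ℝ) : ℂ) by push_cast; linear_combination h] at hw
    simp [Complex.slitPlane] at hw
    linarith
  set S : ℂ → ℂ := fun u => Complex.Gamma u * Complex.Gamma (1 - u) with hS
  -- Off `u = 1` this is `S(u) (w^{-u} - w⁻¹)`. Subtracting `w⁻¹` removes the pole at `1`, and
  -- `dslope` fills in the value there, so the line can move from `c` to `c + 1`. Since `S(u + 1) =
  -- -S(u)`, the sought integral `J` satisfies `J - π/w = π/w - J/w`.
  set f : ℂ → ℂ := fun u =>
    -(Complex.Gamma u * Complex.Gamma (2 - u)) * dslope (fun u => w ^ (-u)) 1 u with hf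
  have ff : ∀ u : ℂ, u ≠ 1 → f u = S u * w ^ (-u) - S u * w⁻¹ := by
    intro u hu
    have h1u : 1 - u ≠ 0 := sub_ne_zero.2 hu.symm
    have hu1 : u - 1 ≠ 0 := sub_ne_zero.2 hu
    simp only [hf, hS]
    rw [dslope_of_ne _ hu, slope_def_field, show (2 : ℂ) - u = (1 - u) + 1 by ring,
      Complex.Gamma_add_one _ h1u, Complex.cpow_neg_one]
    field_simp
    ring
  have Sper : ∀ u : ℂ, S (u + 1) = -S u := by
    intro u
    simp only [hS]
    rw [Complex.Gamma_mul_Gamma_one_sub, Complex.Gamma_mul_Gamma_one_sub, mul_add, mul_one,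
      Complex.sin_add_pi, div_neg]
  have fd : ∀ u : ℂ, c ≤ u.re → u.re ≤ c + 1 → DifferentiableAt ℂ f u := by
    intro u hu1 hu2
    have hG : ∀ s : ℂ, 0 < s.re → DifferentiableAt ℂ Complex.Gamma s := fun s hs =>
      Complex.differentiableAt_Gamma _ fun m hm => by
        have h2 := congrArg Complex.re hm
        have : (0 : ℝ) ≤ m := m.cast_nonneg
        simp at h2
        linarith
    have d1 : DifferentiableAt ℂ (fun u => Complex.Gamma (2 - u)) u :=
      DifferentiableAt.comp (g := Complex.Gamma) u
        (hG _ (by simp only [Complex.sub_re, Complex.re_ofNat]; linarith)) (by fun_prop)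
    have d2 : DifferentiableAt ℂ (dslope (fun u : ℂ => w ^ (-u)) 1) u := by
      have : DifferentiableOn ℂ (dslope (fun u : ℂ => w ^ (-u)) 1) univ :=
        (Complex.differentiableOn_dslope univ_mem).2 fun v _ =>
          (DifferentiableAt.const_cpow (by fun_prop) (Or.inl hw0)).differentiableWithinAt
      exact this.differentiableAt univ_mem
    exact (((hG u (by linarith)).mul d1).neg).mul d2
  obtain ⟨C, hC0, hC⟩ := norm_Gamma_mul_Gamma_one_sub_mul_cpow_le hw0 2
  obtain ⟨K, hK0, hK⟩ := norm_Gamma_mul_Gamma_one_sub_le one_pos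
  have key := integral_vertical_eq_of_exp_decay (f := f) (c₁ := c) (c₂ := c + 1)
    (C := C + K * ‖w⁻¹‖) (by linarith) (sub_pos.2 (abs_arg_lt_pi hw)) fd fun u hu1 hu2 hu3 => by
      have hu : u ≠ 1 := by
        rintro rfl
        simp at hu3
        linarith
      rw [ff u hu, add_mul]
      refine (norm_sub_le _ _).trans (add_le_add (hC u ?_ hu3) ?_)
      · rw [abs_of_pos (by linarith)]; linarith
      · rw [norm_mul, mul_right_comm]
        refine mul_le_mul_of_nonneg_right ((hK u hu3).trans ?_) (norm_nonneg _)
        refine mul_le_mul_of_nonneg_left (Real.exp_le_exp.2 ?_) hK0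
        nlinarith [mul_nonneg (abs_nonneg w.arg) (abs_nonneg u.im)]
  have iJ := integrable_Gamma_mul_Gamma_one_sub_mul_cpow h0 h1 hw
  have iS : Integrable fun y : ℝ => S (c + y * Complex.I) := by
    have h : (1 : ℂ) ∈ Complex.slitPlane := by simp
    simpa using integrable_Gamma_mul_Gamma_one_sub_mul_cpow h0 h1 h
  have hne : ∀ x y : ℝ, x ≠ 1 → (x : ℂ) + y * Complex.I ≠ 1 := fun x y hx h => hx (by
    simpa using congrArg Complex.re h)
  have eS : ∫ y : ℝ, S (c + y * Complex.I) = Real.pi := integral_Gamma_mul_Gamma_one_sub h0 h1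
  have e1 : ∫ y : ℝ, f (c + y * Complex.I) =
      (∫ y : ℝ, S (c + y * Complex.I) * w ^ (-(c + y * Complex.I))) - Real.pi * w⁻¹ := by
    rw [integral_congr_ae (Eventually.of_forall fun y : ℝ => ff _ (hne c y h1.ne)),
      integral_sub iJ (iS.mul_const _), integral_mul_const, eS]
  have e2 : ∫ y : ℝ, f ((c + 1 : ℝ) + y * Complex.I) = Real.pi * w⁻¹ -
      (∫ y : ℝ, S (c + y * Complex.I) * w ^ (-(c + y * Complex.I))) * w⁻¹ := by
    rw [← eS, ← integral_mul_const, ← integral_mul_const,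
      ← integral_sub (iS.mul_const _) (iJ.mul_const _)]
    refine integral_congr_ae (Eventually.of_forall fun y : ℝ => ?_)
    simp only
    rw [ff _ (hne (c + 1) y (by linarith)),
      show (((c + 1 : ℝ) : ℂ) + y * Complex.I) = c + y * Complex.I + 1 by push_cast; ring, Sper,
      neg_add, Complex.cpow_add _ _ hw0, Complex.cpow_neg_one]
    ring
  rw [e1, e2] at key
  rw [eq_div_iff hw1]
  change (∫ y : ℝ, S (c + y * Complex.I) * w ^ (-(c + y * Complex.I))) * (1 + w) = 2 * Real.pi
  generalize (∫ y : ℝ, S (c + y * Complex.I) * w ^ (-(c + y * Complex.I))) = J at key ⊢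
  field_simp at key
  linear_combination key

/-! ### Moments of the Cauchy–Laguerre weight -/

theorem norm_cpow_mul_exp_neg (A : ℂ) (r : ℝ) {x : ℝ} (hx : 0 < x) :
    ‖(x : ℂ) ^ (A - 1) * Complex.exp (-(r * x))‖ = x ^ (A.re - 1) * Real.exp (-(r * x)) := by
  rw [norm_mul, Complex.norm_cpow_eq_rpow_re_of_pos hx, Complex.norm_exp]
  simp

theorem integrableOn_cpow_mul_exp_neg {A : ℂ} (hA : 0 < A.re) {r : ℝ} (hr : 0 < r) :
    IntegrableOn (fun x : ℝ => (x : ℂ) ^ (A - 1) * Complex.exp (-(r * x))) (Ioi 0) := by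
  have h := integrableOn_rpow_mul_exp_neg_mul_rpow (s := A.re - 1) (by linarith) one_pos hr
  refine Integrable.mono' h (Measurable.aestronglyMeasurable (by fun_prop)) ?_
  filter_upwards [ae_restrict_mem measurableSet_Ioi] with x hx
  rw [norm_cpow_mul_exp_neg A r hx, Real.rpow_one, neg_mul]

/-- Writing `e^{-x-y} / (x + y)` as `∫ e^{-(1+s)(x+y)} ds` over `s > 0` decouples `x` from `y`. For
fixed `s` the absolute values integrate to `Γ(Re A) Γ(Re B) (1 + s)^{-Re(A + B)}`, which is
integrable in `s` because `Re A + Re B > 1`. -/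
theorem integrable_cauchy_exp_prod {A B : ℂ} (hA : 0 < A.re) (hB : 0 < B.re)
    (hAB : 1 < A.re + B.re) :
    Integrable (fun p : ℝ × ℝ × ℝ =>
      ((p.2.1 : ℂ) ^ (A - 1) * Complex.exp (-((1 + p.1 : ℝ) * p.2.1))) *
        ((p.2.2 : ℂ) ^ (B - 1) * Complex.exp (-((1 + p.1 : ℝ) * p.2.2))))
      ((volume.restrict (Ioi (0 : ℝ))).prod
        ((volume.restrict (Ioi (0 : ℝ))).prod (volume.restrict (Ioi (0 : ℝ))))) := by
  rw [integrable_prod_iff (Measurable.aestronglyMeasurable (by fun_prop))]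
  constructor
  · filter_upwards [ae_restrict_mem measurableSet_Ioi] with s hs
    have hs1 : 0 < 1 + s := by linarith [mem_Ioi.1 hs]
    exact (integrableOn_cpow_mul_exp_neg hA hs1).mul_prod (integrableOn_cpow_mul_exp_neg hB hs1)
  · have hi : IntegrableOn (fun s : ℝ => (s + 1) ^ (-(A.re + B.re)) *
        (Real.Gamma A.re * Real.Gamma B.re)) (Ioi 0) :=
      (integrableOn_add_rpow_Ioi_of_lt (by linarith) (by norm_num)).mul_const _
    refine Integrable.congr hi ?_
    filter_upwards [ae_restrict_mem measurableSet_Ioi] with s hs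
    have hs1 : 0 < 1 + s := by linarith [mem_Ioi.1 hs]
    have h1 : ∀ C : ℂ, 0 < C.re →
        ∫ x in Ioi (0 : ℝ), ‖(x : ℂ) ^ (C - 1) * Complex.exp (-((1 + s : ℝ) * x))‖ =
        (1 / (1 + s)) ^ C.re * Real.Gamma C.re := by
      intro C hC
      rw [← Real.integral_rpow_mul_exp_neg_mul_Ioi hC hs1]
      exact setIntegral_congr_fun measurableSet_Ioi fun x hx => norm_cpow_mul_exp_neg C (1 + s) hx
    simp only [norm_mul] at h1 ⊢
    rw [integral_prod_mul (fun x : ℝ => ‖(x : ℂ) ^ (A - 1)‖ * ‖Complex.exp (-((1 + s : ℝ) * x))‖)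
      (fun x : ℝ => ‖(x : ℂ) ^ (B - 1)‖ * ‖Complex.exp (-((1 + s : ℝ) * x))‖), h1 A hA, h1 B hB,
      one_div, Real.inv_rpow hs1.le, Real.inv_rpow hs1.le, add_comm s 1, Real.rpow_neg hs1.le,
      Real.rpow_add hs1, mul_inv]
    ring

theorem integral_cauchy_exp {A B : ℂ} {x y : ℝ} (hx : 0 < x) (hy : 0 < y) :
    ∫ s in Ioi (0 : ℝ), ((x : ℂ) ^ (A - 1) * Complex.exp (-((1 + s : ℝ) * x))) *
        ((y : ℂ) ^ (B - 1) * Complex.exp (-((1 + s : ℝ) * y))) =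
      (x : ℂ) ^ (A - 1) * (y : ℂ) ^ (B - 1) * (Real.exp (-x - y) / (x + y) : ℝ) := by
  have h : ∀ s : ℝ, ((x : ℂ) ^ (A - 1) * Complex.exp (-((1 + s : ℝ) * x))) *
        ((y : ℂ) ^ (B - 1) * Complex.exp (-((1 + s : ℝ) * y))) =
      (x : ℂ) ^ (A - 1) * (y : ℂ) ^ (B - 1) *
        ((Real.exp (-x - y) * Real.exp (-(x + y) * s) : ℝ) : ℂ) := by
    intro s
    rw [← Real.exp_add]
    push_cast
    rw [show -(x : ℂ) - y + -(x + y) * s = -((1 + s) * x) + -((1 + s) * y) by ring, Complex.exp_add]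
    ring
  simp only [h]
  rw [integral_const_mul, integral_complex_ofReal, integral_const_mul,
    integral_exp_mul_Ioi (by linarith), mul_zero, Real.exp_zero, neg_div_neg_eq, mul_one_div]

theorem volume_restrict_quadrant :
    (volume : Measure (ℝ × ℝ)).restrict (Ioi (0 : ℝ) ×ˢ Ioi (0 : ℝ)) =
      (volume.restrict (Ioi (0 : ℝ))).prod (volume.restrict (Ioi (0 : ℝ))) := by
  rw [Measure.prod_restrict, Measure.volume_eq_prod]

theorem integrableOn_cauchy_moment {A B : ℂ} (hA : 0 < A.re) (hB : 0 < B.re)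
    (hAB : 1 < A.re + B.re) :
    IntegrableOn (fun w : ℝ × ℝ => (w.1 : ℂ) ^ (A - 1) * (w.2 : ℂ) ^ (B - 1) *
      (Real.exp (-w.1 - w.2) / (w.1 + w.2) : ℝ)) (Ioi (0 : ℝ) ×ˢ Ioi (0 : ℝ)) := by
  have h := (integrable_cauchy_exp_prod hA hB hAB).integral_prod_right
  rw [← volume_restrict_quadrant] at h
  refine Integrable.congr h ?_
  filter_upwards [ae_restrict_mem (measurableSet_Ioi.prod measurableSet_Ioi)] with w hw
  exact integral_cauchy_exp hw.1 hw.2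

/-- The moments of the Cauchy-Laguerre weight. -/
theorem integral_cauchy_moment {A B : ℂ} (hA : 0 < A.re) (hB : 0 < B.re)
    (hAB : 1 < A.re + B.re) :
    ∫ w in Ioi (0 : ℝ) ×ˢ Ioi (0 : ℝ), (w.1 : ℂ) ^ (A - 1) * (w.2 : ℂ) ^ (B - 1) *
      (Real.exp (-w.1 - w.2) / (w.1 + w.2) : ℝ) =
      Complex.Gamma A * Complex.Gamma B / (A + B - 1) := by
  have h := integral_integral_swap (f := fun (s : ℝ) (w : ℝ × ℝ) =>
      ((w.1 : ℂ) ^ (A - 1) * Complex.exp (-((1 + s : ℝ) * w.1))) *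
        ((w.2 : ℂ) ^ (B - 1) * Complex.exp (-((1 + s : ℝ) * w.2))))
    (integrable_cauchy_exp_prod hA hB hAB)
  rw [← volume_restrict_quadrant] at h
  rw [setIntegral_congr_fun (measurableSet_Ioi.prod measurableSet_Ioi) fun w hw =>
    (integral_cauchy_exp (A := A) (B := B) hw.1 hw.2).symm, ← h]
  have h1 : ∀ s ∈ Ioi (0 : ℝ), ∫ w in Ioi (0 : ℝ) ×ˢ Ioi (0 : ℝ),
      ((w.1 : ℂ) ^ (A - 1) * Complex.exp (-((1 + s : ℝ) * w.1))) *
        ((w.2 : ℂ) ^ (B - 1) * Complex.exp (-((1 + s : ℝ) * w.2))) =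
      ((s + (1 : ℝ) : ℝ) : ℂ) ^ (-(A + B)) * (Complex.Gamma A * Complex.Gamma B) := by
    intro s hs
    have hs1 : 0 < 1 + s := by linarith [mem_Ioi.1 hs]
    have hs0 : ((1 + s : ℝ) : ℂ) ≠ 0 := by exact_mod_cast hs1.ne'
    have harg : ((1 + s : ℝ) : ℂ).arg ≠ Real.pi := by
      rw [Complex.arg_ofReal_of_nonneg hs1.le]; exact Real.pi_pos.ne
    rw [volume_restrict_quadrant,
      integral_prod_mul (fun x : ℝ => (x : ℂ) ^ (A - 1) * Complex.exp (-((1 + s : ℝ) * x)))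
        (fun x : ℝ => (x : ℂ) ^ (B - 1) * Complex.exp (-((1 + s : ℝ) * x))),
      Complex.integral_cpow_mul_exp_neg_mul_Ioi hA hs1,
      Complex.integral_cpow_mul_exp_neg_mul_Ioi hB hs1, one_div, Complex.inv_cpow _ _ harg,
      Complex.inv_cpow _ _ harg, add_comm s 1, Complex.cpow_neg, Complex.cpow_add _ _ hs0, mul_inv]
    ring
  rw [setIntegral_congr_fun measurableSet_Ioi h1, integral_mul_const]
  have h2 : ∫ s in Ioi (0 : ℝ), ((s + (1 : ℝ) : ℝ) : ℂ) ^ (-(A + B)) = 1 / (A + B - 1) := by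
    have := (measurePreserving_add_right (volume : Measure ℝ) 1).setIntegral_preimage_emb
      (measurableEmbedding_addRight 1) (fun s : ℝ => (s : ℂ) ^ (-(A + B))) (Ioi 1)
    rw [Set.preimage_add_const_Ioi, sub_self] at this
    rw [this, integral_Ioi_cpow_of_lt (by simp; linarith) one_pos, Complex.ofReal_one,
      Complex.one_cpow, ← neg_div_neg_eq]
    congr 1
    · ring
    · ring
  rw [h2]
  ring

/-! ### Partial fractions and dual functionals -/

/-- A partial fraction with simple poles at `0, -1, …, -n` is determined by `n` zeros and the
residue at `-n`. -/
theorem sum_div_add_eq_of_zeros {K : Type*} [Field K] [CharZero K] (α : K)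
    (hα : ∀ k : ℕ, α + k + 1 ≠ 0) (n : ℕ) (d : ℕ → K)
    (h : ∀ k < n, ∑ j ∈ Finset.range (n + 1), d j / (α + (k : ℕ) + 1 + j) = 0) (s : K)
    (hs : ∀ j : ℕ, s + j ≠ 0) :
    ∑ j ∈ Finset.range (n + 1), d j / (s + j) =
      d n * n.factorial / (∏ k ∈ Finset.range n, (α + n + k + 1)) *
        ((∏ k ∈ Finset.range n, (s - α - (k + 1))) / ∏ j ∈ Finset.range (n + 1), (s + j)) := by
  classical
  have hneg : ∀ f : ℕ → K, (-1) ^ n * ∏ k ∈ Finset.range n, f k = ∏ k ∈ Finset.range n, -f k :=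
    fun f => by rw [Finset.prod_neg, Finset.card_range]
  set N : K[X] := ∑ j ∈ Finset.range (n + 1),
    C (d j) * ∏ i ∈ (Finset.range (n + 1)).erase j, (X + C (i : K)) with hN
  -- The constant for which the residue of the product form at `-n` is `d n`; the signs `(-1)^n`
  -- from numerator and denominator cancel.
  set D : K := d n * n.factorial / (∏ k ∈ Finset.range n, (α + n + k + 1)) with hD
  set Q : K[X] := C D * ∏ k ∈ Finset.range n, (X - C (α + k + 1)) with hQ
  have evN : ∀ t : K, (∀ j ∈ Finset.range (n + 1), t + j ≠ 0) →
      N.eval t = (∑ j ∈ Finset.range (n + 1), d j / (t + j)) *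
        ∏ j ∈ Finset.range (n + 1), (t + j) := by
    intro t ht
    rw [hN, eval_finsetSum, Finset.sum_mul]
    refine Finset.sum_congr rfl fun j hj => ?_
    rw [← Finset.mul_prod_erase _ _ hj, eval_mul, eval_C, eval_prod, ← mul_assoc,
      div_mul_cancel₀ _ (ht j hj)]
    simp
  have hP : ∏ k ∈ Finset.range n, (α + n + k + 1) ≠ 0 :=
    Finset.prod_ne_zero_iff.2 fun k _ => by
      have := hα (n + k)
      rwa [Nat.cast_add, ← add_assoc] at this
  -- Both polynomials have degree at most `n` and agree at `n + 1` points: `-n` and the zeros `α + k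
  -- + 1`. By `hα` these points are distinct and the zeros avoid the poles.
  have hNQ : N = Q := by
    set S : Finset K := insert (-(n : K)) ((Finset.range n).image fun k : ℕ => α + k + 1) with hS
    have hcard : S.card = n + 1 := by
      rw [hS, Finset.card_insert_of_notMem, Finset.card_image_of_injective, Finset.card_range]
      · intro x y hxy
        simpa using hxy
      · intro hmem
        obtain ⟨k, -, hk⟩ := Finset.mem_image.1 hmem
        apply hα (n + k)
        push_cast
        linear_combination hk
    refine Polynomial.eq_of_degree_sub_lt_of_eval_finset_eq S ?_ ?_
    · rw [hcard]
      have hlt : ((n : ℕ) : WithBot ℕ) < ((n + 1 : ℕ) : WithBot ℕ) := by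
        exact_mod_cast n.lt_succ_self
      refine (degree_sub_le _ _).trans_lt (max_lt ?_ ?_)
      · refine ((degree_sum_le _ _).trans (Finset.sup_le fun j hj => ?_)).trans_lt hlt
        refine (degree_mul_le _ _).trans ((add_le_of_nonpos_left degree_C_le).trans ?_)
        rw [degree_prod, Finset.sum_congr rfl fun (i : ℕ) _ => degree_X_add_C (i : K), Finset.sum_const,
          Finset.card_erase_of_mem hj, Finset.card_range]
        simp
      · refine ((degree_mul_le _ _).trans
          ((add_le_of_nonpos_left degree_C_le).trans ?_)).trans_lt hlt
        rw [degree_prod, Finset.sum_congr rfl fun (k : ℕ) _ => degree_X_sub_C (α + (k : K) + 1),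
          Finset.sum_const, Finset.card_range]
        simp
    · intro t ht
      rcases Finset.mem_insert.1 ht with rfl | ht
      · have e1 : N.eval (-(n : K)) = d n * ((-1) ^ n * n.factorial) := by
          rw [hN, eval_finsetSum, Finset.sum_eq_single n]
          · rw [eval_mul, eval_C, eval_prod, Finset.range_add_one,
              Finset.erase_insert Finset.notMem_range_self,
              ← Finset.prod_range_reflect, ← Finset.prod_range_add_one_eq_factorial]
            push_cast
            rw [hneg]
            congr 1
            refine Finset.prod_congr rfl fun k hk => ?_
            have hk := Finset.mem_range.1 hk
            rw [eval_add, eval_X, eval_C, Nat.sub_sub, Nat.cast_sub (by omega)]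
            push_cast
            ring
          · intro j _ hj
            rw [eval_mul, eval_prod, Finset.prod_eq_zero (i := n), mul_zero]
            · simp [Ne.symm hj]
            · simp
          · simp
        have e2 : Q.eval (-(n : K)) =
            D * ((-1) ^ n * ∏ k ∈ Finset.range n, (α + n + k + 1)) := by
          rw [hQ, eval_mul, eval_C, eval_prod]
          congr 1
          rw [hneg]
          refine Finset.prod_congr rfl fun k _ => ?_
          simp
          ring
        rw [e1, e2, hD]
        field_simp
      · obtain ⟨k, hk, rfl⟩ := Finset.mem_image.1 ht
        rw [evN, h k (Finset.mem_range.1 hk), zero_mul, hQ, eval_mul, eval_prod,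
          Finset.prod_eq_zero hk, mul_zero]
        · simp
        · intro j _
          have := hα (k + j)
          push_cast at this
          rwa [show α + k + 1 + j = α + (k + j) + 1 by ring]
  have hP2 : ∏ j ∈ Finset.range (n + 1), (s + j) ≠ 0 := Finset.prod_ne_zero_iff.2 fun j _ => hs j
  rw [← mul_div_assoc, eq_div_iff hP2, ← evN s fun j _ => hs j, hNQ, hQ, eval_mul, eval_C, eval_prod]
  congr 1
  refine Finset.prod_congr rfl fun k _ => ?_
  simp
  ring

/-- Since `q m` has exact degree `m`, the `q m` with `m < n` span the polynomials of degree less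
than `n`; the induction strips off the top coefficient. -/
theorem LinearMap.eq_zero_of_degree_lt_of_dual (L : ℝ[X] →ₗ[ℝ] ℝ) (q : ℕ → ℝ[X])
    (hq : ∀ m, (q m).natDegree = m) (hq0 : ∀ m, (q m).leadingCoeff ≠ 0) (n : ℕ)
    (hL : ∀ m < n, L (q m) = 0) (g : ℝ[X]) (hg : g.degree < n) : L g = 0 := by
  induction n generalizing g with
  | zero =>
    have : g = 0 := by
      ext k
      exact (degree_lt_iff_coeff_zero _ _).1 hg k k.zero_le
    rw [this, map_zero]
  | succ m ih =>
    set t := g.coeff m / (q m).leadingCoeff with ht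
    have hlt : (g - t • q m).degree < m := by
      rw [degree_lt_iff_coeff_zero]
      intro k hk
      rw [coeff_sub, coeff_smul, smul_eq_mul]
      rcases hk.eq_or_lt with rfl | hk
      · have : (q m).coeff m = (q m).leadingCoeff := by rw [leadingCoeff, hq]
        rw [this, ht, div_mul_cancel₀ _ (hq0 m), sub_self]
      · rw [(degree_lt_iff_coeff_zero _ _).1 hg k hk, coeff_eq_zero_of_natDegree_lt (by rwa [hq])]
        simp
    have := ih (fun k hk => hL k (hk.trans m.lt_succ_self)) _ hlt
    rwa [map_sub, map_smul, hL m m.lt_succ_self, smul_zero, sub_zero] at this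

theorem LinearMap.leadingCoeff_mul_eq_of_dual (L : ℝ[X] →ₗ[ℝ] ℝ) (q : ℕ → ℝ[X])
    (hq : ∀ m, (q m).natDegree = m) (hq0 : ∀ m, (q m).leadingCoeff ≠ 0) (n : ℕ)
    (hL : ∀ m < n, L (q m) = 0) : (q n).leadingCoeff * L (X ^ n) = L (q n) := by
  have hlt : (q n - (q n).leadingCoeff • (X ^ n : ℝ[X])).degree < (n : WithBot ℕ) := by
    rw [degree_lt_iff_coeff_zero]
    intro k hk
    rw [coeff_sub, coeff_smul, smul_eq_mul, coeff_X_pow]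
    rcases hk.eq_or_lt with rfl | hk
    · rw [leadingCoeff, hq]; simp
    · rw [coeff_eq_zero_of_natDegree_lt (by rwa [hq]), if_neg hk.ne']; simp
  have := L.eq_zero_of_degree_lt_of_dual q hq hq0 n hL _ hlt
  rw [map_sub, map_smul, smul_eq_mul] at this
  linarith

/-! ### The moment function of `p_n` and its product form -/

/-- The rational function `∑ f_j Γ(a + j + 1) / (s + j)`; up to a Gamma factor it is the moment of
`f` against `y ↦ y^s`. -/
def cauchyMoment (a : ℝ) (f : ℝ[X]) (s : ℂ) : ℂ :=
  ∑ j ∈ Finset.range (f.natDegree + 1),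
    (f.coeff j : ℂ) * (Real.Gamma (a + j + 1) : ℂ) / (s + j)

theorem eval_mul_cpow_eq_sum (a : ℝ) (f : ℝ[X]) (B : ℂ) {w : ℝ × ℝ}
    (hw : w ∈ Ioi (0 : ℝ) ×ˢ Ioi (0 : ℝ)) :
    ((f.eval w.1 * w.1 ^ a * (Real.exp (-w.1 - w.2) / (w.1 + w.2)) : ℝ) : ℂ) * (w.2 : ℂ) ^ (B - 1) =
      ∑ j ∈ Finset.range (f.natDegree + 1), (f.coeff j : ℂ) *
        ((w.1 : ℂ) ^ ((a + j + 1 : ℝ) - 1 : ℂ) * (w.2 : ℂ) ^ (B - 1) *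
          (Real.exp (-w.1 - w.2) / (w.1 + w.2) : ℝ)) := by
  have h1 : 0 < w.1 := hw.1
  rw [eval_eq_sum_range, Finset.sum_mul, Finset.sum_mul, Complex.ofReal_sum, Finset.sum_mul]
  refine Finset.sum_congr rfl fun j _ => ?_
  have : (w.1 : ℂ) ^ ((a + j + 1 : ℝ) - 1 : ℂ) = ((w.1 ^ j * w.1 ^ a : ℝ) : ℂ) := by
    rw [← Real.rpow_natCast, ← Real.rpow_add h1, Complex.ofReal_cpow h1.le]
    push_cast
    ring_nf
  rw [this]
  push_cast
  ring

theorem integrableOn_eval_mul_cpow {a : ℝ} (ha : -1 < a) (f : ℝ[X]) {B : ℂ} (hB : 0 < B.re)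
    (haB : 0 < a + B.re) :
    IntegrableOn (fun w : ℝ × ℝ =>
      ((f.eval w.1 * w.1 ^ a * (Real.exp (-w.1 - w.2) / (w.1 + w.2)) : ℝ) : ℂ) *
        (w.2 : ℂ) ^ (B - 1)) (Ioi (0 : ℝ) ×ˢ Ioi (0 : ℝ)) := by
  refine IntegrableOn.congr_fun ?_ (fun w hw => (eval_mul_cpow_eq_sum a f B hw).symm)
    (measurableSet_Ioi.prod measurableSet_Ioi)
  refine integrable_finsetSum _ fun j _ => ?_
  have hj : (0 : ℝ) ≤ j := j.cast_nonneg
  refine (integrableOn_cauchy_moment ?_ hB ?_).const_mul _ <;> rw [Complex.ofReal_re] <;> linarith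

theorem integral_eval_mul_cpow {a : ℝ} (ha : -1 < a) (f : ℝ[X]) {B : ℂ} (hB : 0 < B.re)
    (haB : 0 < a + B.re) :
    ∫ w in Ioi (0 : ℝ) ×ˢ Ioi (0 : ℝ),
      ((f.eval w.1 * w.1 ^ a * (Real.exp (-w.1 - w.2) / (w.1 + w.2)) : ℝ) : ℂ) *
        (w.2 : ℂ) ^ (B - 1) = Complex.Gamma B * cauchyMoment a f (a + B) := by
  have hA : ∀ j : ℕ, 0 < ((a + j + 1 : ℝ) : ℂ).re := fun j => by
    have hj : (0 : ℝ) ≤ j := j.cast_nonneg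
    rw [Complex.ofReal_re]; linarith
  have hAB : ∀ j : ℕ, 1 < ((a + j + 1 : ℝ) : ℂ).re + B.re := fun j => by
    have hj : (0 : ℝ) ≤ j := j.cast_nonneg
    rw [Complex.ofReal_re]; linarith
  rw [setIntegral_congr_fun (measurableSet_Ioi.prod measurableSet_Ioi) fun w hw =>
    eval_mul_cpow_eq_sum a f B hw, integral_finsetSum _ fun j _ =>
      (integrableOn_cauchy_moment (hA j) hB (hAB j)).const_mul _, cauchyMoment, Finset.mul_sum]
  refine Finset.sum_congr rfl fun j _ => ?_
  rw [integral_const_mul, integral_cauchy_moment (hA j) hB (hAB j), Complex.Gamma_ofReal,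
    show ((a + j + 1 : ℝ) : ℂ) + B - 1 = a + B + j by push_cast; ring]
  ring

/-- The weight of the Cauchy-Laguerre pairing. -/
def cauchyLaguerreWeight (a b : ℝ) (w : ℝ × ℝ) : ℝ :=
  w.1 ^ a * w.2 ^ b * Real.exp (-w.1 - w.2) / (w.1 + w.2)

theorem ofReal_eval_mul_pow_mul_weight (a b : ℝ) (f : ℝ[X]) (k : ℕ) {w : ℝ × ℝ}
    (hw : w ∈ Ioi (0 : ℝ) ×ˢ Ioi (0 : ℝ)) :
    ((f.eval w.1 * w.2 ^ k * cauchyLaguerreWeight a b w : ℝ) : ℂ) =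
      ((f.eval w.1 * w.1 ^ a * (Real.exp (-w.1 - w.2) / (w.1 + w.2)) : ℝ) : ℂ) *
        (w.2 : ℂ) ^ (((b + k + 1 : ℝ) : ℂ) - 1) := by
  have h2 : 0 < w.2 := hw.2
  have : (w.2 : ℂ) ^ ((b + k + 1 : ℝ) - 1 : ℂ) = ((w.2 ^ k * w.2 ^ b : ℝ) : ℂ) := by
    rw [← Real.rpow_natCast, ← Real.rpow_add h2, Complex.ofReal_cpow h2.le]
    push_cast
    ring_nf
  rw [this, cauchyLaguerreWeight]
  push_cast
  ring

theorem integrableOn_eval_mul_pow_mul_weight {a b : ℝ} (ha : -1 < a) (hb : -1 < b)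
    (hab : -1 < a + b) (f : ℝ[X]) (k : ℕ) :
    IntegrableOn (fun w : ℝ × ℝ => f.eval w.1 * w.2 ^ k * cauchyLaguerreWeight a b w)
      (Ioi (0 : ℝ) ×ˢ Ioi (0 : ℝ)) := by
  have hk : (0 : ℝ) ≤ k := k.cast_nonneg
  have h := integrableOn_eval_mul_cpow ha f (B := ((b + k + 1 : ℝ) : ℂ))
    (by rw [Complex.ofReal_re]; linarith) (by rw [Complex.ofReal_re]; linarith)
  have h2 := h.congr_fun (fun w hw => (ofReal_eval_mul_pow_mul_weight a b f k hw).symm)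
    (measurableSet_Ioi.prod measurableSet_Ioi)
  exact h2.re.congr (Eventually.of_forall fun w => Complex.ofReal_re _)

theorem integral_eval_mul_pow_mul_weight {a b : ℝ} (ha : -1 < a) (hb : -1 < b)
    (hab : -1 < a + b) (f : ℝ[X]) (k : ℕ) :
    ((∫ w in Ioi (0 : ℝ) ×ˢ Ioi (0 : ℝ), f.eval w.1 * w.2 ^ k * cauchyLaguerreWeight a b w : ℝ) : ℂ) =
      Real.Gamma (b + k + 1) * cauchyMoment a f ((a + b : ℝ) + k + 1) := by
  have hk : (0 : ℝ) ≤ k := k.cast_nonneg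
  rw [← integral_complex_ofReal, setIntegral_congr_fun (measurableSet_Ioi.prod measurableSet_Ioi)
    fun w hw => ofReal_eval_mul_pow_mul_weight a b f k hw,
    integral_eval_mul_cpow ha f (by rw [Complex.ofReal_re]; linarith)
      (by rw [Complex.ofReal_re]; linarith), Complex.Gamma_ofReal]
  congr 2
  push_cast
  ring

theorem integrableOn_eval_mul_eval_mul_weight {a b : ℝ} (ha : -1 < a) (hb : -1 < b)
    (hab : -1 < a + b) (f g : ℝ[X]) :
    IntegrableOn (fun w : ℝ × ℝ => f.eval w.1 * g.eval w.2 * cauchyLaguerreWeight a b w)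
      (Ioi (0 : ℝ) ×ˢ Ioi (0 : ℝ)) := by
  induction g using Polynomial.induction_on' with
  | add g h hg hh =>
    refine (Integrable.add hg hh).congr (Eventually.of_forall fun w => ?_)
    simp only [Pi.add_apply, eval_add]
    ring
  | monomial k c =>
    refine ((integrableOn_eval_mul_pow_mul_weight ha hb hab f k).const_mul c).congr
      (Eventually.of_forall fun w => ?_)
    simp only [eval_monomial]
    ring

/-- The Cauchy-Laguerre pairing with a fixed polynomial, as a linear functional. -/
def cauchyLaguerrePairing {a b : ℝ} (ha : -1 < a) (hb : -1 < b) (hab : -1 < a + b) (f : ℝ[X]) :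
    ℝ[X] →ₗ[ℝ] ℝ where
  toFun g := ∫ w in Ioi (0 : ℝ) ×ˢ Ioi (0 : ℝ),
    f.eval w.1 * g.eval w.2 * cauchyLaguerreWeight a b w
  map_add' g h := by
    rw [← integral_add (integrableOn_eval_mul_eval_mul_weight ha hb hab f g)
      (integrableOn_eval_mul_eval_mul_weight ha hb hab f h)]
    simp only [eval_add, mul_add, add_mul]
  map_smul' c g := by
    rw [RingHom.id_apply, smul_eq_mul, ← integral_const_mul]
    refine integral_congr_ae (Eventually.of_forall fun w => ?_)
    simp only [eval_smul, smul_eq_mul]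
    ring

theorem cauchyLaguerrePairing_X_pow {a b : ℝ} (ha : -1 < a) (hb : -1 < b) (hab : -1 < a + b)
    (f : ℝ[X]) (k : ℕ) : ((cauchyLaguerrePairing ha hb hab f (X ^ k) : ℝ) : ℂ) =
      Real.Gamma (b + k + 1) * cauchyMoment a f ((a + b : ℝ) + k + 1) := by
  rw [← integral_eval_mul_pow_mul_weight ha hb hab f k]
  simp [cauchyLaguerrePairing]

/-- The pairing of `p_n` with `y^k` is `Γ(b + k + 1) F(α + k + 1)`, so orthogonality provides the
`n` zeros required by `sum_div_add_eq_of_zeros`, and the value at `k = n` fixes the constant. -/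
theorem IsCauchyLaguerreBiorthonormal.cauchyMoment_eq {a b : ℝ} (ha : -1 < a) (hb : -1 < b)
    (hab : -1 < a + b) {p q : ℕ → ℝ[X]} (hpq : IsCauchyLaguerreBiorthonormal a b p q) (n : ℕ)
    {s : ℂ} (hs : ∀ j : ℕ, s + j ≠ 0) :
    cauchyMoment a (p n) s = normConst a b n *
      ((∏ k ∈ Finset.range n, (s - (a + b : ℝ) - (k + 1))) /
        ∏ j ∈ Finset.range (n + 1), (s + j)) := by
  set α := a + b
  set L := cauchyLaguerrePairing ha hb hab (p n)
  have hL : ∀ m, L (q m) = if n = m then 1 else 0 := fun m => hpq.pairing n m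
  have hq0 : ∀ m, (q m).leadingCoeff ≠ 0 := fun m => by
    rw [← hpq.leadingCoeff_eq]; exact (hpq.leadingCoeff_pos m).ne'
  have hL0 : ∀ m < n, L (q m) = 0 := fun m hm => by rw [hL, if_neg hm.ne']
  have hGb : ∀ k : ℕ, 0 < Real.Gamma (b + k + 1) := fun k => Real.Gamma_pos_of_pos (by
    have hk : (0 : ℝ) ≤ k := k.cast_nonneg
    linarith)
  have hGa : 0 < Real.Gamma (a + n + 1) := Real.Gamma_pos_of_pos (by
    have hk : (0 : ℝ) ≤ n := n.cast_nonneg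
    linarith)
  have hαC : ∀ k : ℕ, (α : ℂ) + k + 1 ≠ 0 := fun k h => by
    have hk : (0 : ℝ) ≤ k := k.cast_nonneg
    have h : α + k + 1 = 0 := by exact_mod_cast h
    linarith
  have hzero : ∀ k < n, cauchyMoment a (p n) ((α : ℂ) + k + 1) = 0 := by
    intro k hk
    have h1 := cauchyLaguerrePairing_X_pow ha hb hab (p n) k
    rw [L.eq_zero_of_degree_lt_of_dual q hpq.natDegree_right hq0 n hL0 _ (by
      rw [degree_X_pow]; exact_mod_cast hk), Complex.ofReal_zero] at h1
    refine (mul_eq_zero.1 h1.symm).resolve_left ?_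
    exact_mod_cast (hGb k).ne'
  have hpf : ∀ s : ℂ, (∀ j : ℕ, s + j ≠ 0) → cauchyMoment a (p n) s =
      (p n).coeff n * Real.Gamma (a + n + 1) * n.factorial /
        (∏ k ∈ Finset.range n, ((α : ℂ) + n + k + 1)) *
        ((∏ k ∈ Finset.range n, (s - α - (k + 1))) / ∏ j ∈ Finset.range (n + 1), (s + j)) :=
    fun s hs => by
    have hd := hpq.natDegree_left n
    have := sum_div_add_eq_of_zeros (α : ℂ) hαC n
      (fun j => ((p n).coeff j : ℂ) * (Real.Gamma (a + j + 1) : ℂ))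
      (fun k hk => by simpa only [cauchyMoment, hd] using hzero k hk) s hs
    rw [cauchyMoment, hd]
    exact this
  set κ := (p n).leadingCoeff with hκ
  have hκ0 : 0 < κ := hpq.leadingCoeff_pos n
  have hcoeff : (p n).coeff n = κ := by rw [hκ, leadingCoeff, hpq.natDegree_left]
  rw [hcoeff] at hpf
  set P : ℝ := ∏ k ∈ Finset.range n, (α + n + k + 1) with hP
  have hP0 : 0 < P := Finset.prod_pos fun k _ => by
    have hk : (0 : ℝ) ≤ k := k.cast_nonneg
    have hn : (0 : ℝ) ≤ n := n.cast_nonneg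
    linarith
  set D : ℝ := κ * Real.Gamma (a + n + 1) * n.factorial / P with hD
  have hD0 : 0 < D := by positivity
  have hDC : (κ : ℂ) * Real.Gamma (a + n + 1) * n.factorial /
      (∏ k ∈ Finset.range n, ((α : ℂ) + n + k + 1)) = D := by
    rw [hD, hP]; push_cast; rfl
  rw [hDC] at hpf
  -- This is `⟨p_n, q_n⟩ = 1`: only the leading term `κ y^n` of `q_n` contributes, and `κ` is shared
  -- with `p_n`.
  have hnorm : κ * (Real.Gamma (b + n + 1) * (D * (n.factorial / (P * (2 * n + α + 1))))) = 1 := by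
    have h1 := L.leadingCoeff_mul_eq_of_dual q hpq.natDegree_right hq0 n hL0
    rw [hL, if_pos rfl, ← hpq.leadingCoeff_eq] at h1
    have h2 := cauchyLaguerrePairing_X_pow ha hb hab (p n) n
    rw [hpf _ fun j h => hαC (n + j) (by push_cast; linear_combination h)] at h2
    have h3 : ∏ k ∈ Finset.range n, ((α : ℂ) + n + 1 - α - (k + 1)) = n.factorial := by
      rw [← Finset.prod_range_reflect, ← Finset.prod_range_add_one_eq_factorial]
      push_cast
      refine Finset.prod_congr rfl fun k hk => ?_
      have hk := Finset.mem_range.1 hk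
      rw [Nat.sub_sub, Nat.cast_sub (by omega)]
      push_cast
      ring
    have h4 : ∏ j ∈ Finset.range (n + 1), ((α : ℂ) + n + 1 + j) = P * (2 * n + α + 1) := by
      rw [Finset.prod_range_succ, hP]
      push_cast
      congr 1
      · exact Finset.prod_congr rfl fun k _ => by ring
      · ring
    rw [h3, h4] at h2
    have h5 : L (X ^ n) =
        Real.Gamma (b + n + 1) * (D * (n.factorial / (P * (2 * n + α + 1)))) := by
      exact_mod_cast h2
    rwa [h5] at h1
  -- Eliminating `κ` between `hnorm` and the definition of `D` determines `D²`; positivity of `κ`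
  -- selects the positive root.
  have hDn : D = normConst a b n := by
    have hn : (0 : ℝ) ≤ n := n.cast_nonneg
    have hpos : 0 < 2 * n + α + 1 := by linarith
    have hf : (0 : ℝ) < n.factorial := by positivity
    have hGbn := hGb n
    have hκD : κ = D * P / (Real.Gamma (a + n + 1) * n.factorial) := by
      rw [hD]; field_simp
    have hsq : D ^ 2 = (2 * n + α + 1) * (Real.Gamma (a + n + 1) / Real.Gamma (b + n + 1)) := by
      rw [hκD] at hnorm
      generalize 2 * (n : ℝ) + α + 1 = ν at hpos hnorm ⊢
      field_simp at hnorm ⊢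
      linarith
    rw [normConst, ← Real.sqrt_mul hpos.le, ← hsq, Real.sqrt_sq hD0.le]
  rw [hpf s hs, hDn]

/-! ### Exchange of integrals and the theorem -/

/-- The formula for `1 / (1 + w)` at `w = z / y`. Dividing by `y > 0` preserves the argument, so `w`
stays off the cut and the principal power splits as `z^{-u} y^u`. -/
theorem div_add_eq_integral {c : ℝ} (h0 : 0 < c) (h1 : c < 1) {z : ℂ} (hz : z ∈ Complex.slitPlane)
    {y : ℝ} (hy : 0 < y) :
    (y : ℂ) / (z + y) = (2 * (Real.pi : ℂ))⁻¹ * ∫ t : ℝ, Complex.Gamma (c + t * Complex.I) *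
      Complex.Gamma (1 - (c + t * Complex.I)) * z ^ (-(c + t * Complex.I)) *
        (y : ℂ) ^ (c + t * Complex.I) := by
  have hz0 := Complex.slitPlane_ne_zero hz
  have hy0 : (y : ℂ) ≠ 0 := by exact_mod_cast hy.ne'
  have hlog : Complex.log ((y⁻¹ : ℝ) * z) = Complex.log z - Real.log y := by
    rw [Complex.log_ofReal_mul (inv_pos.2 hy) hz0, Real.log_inv]
    push_cast
    ring
  have hw0 : ((y⁻¹ : ℝ) : ℂ) * z ≠ 0 := mul_ne_zero (by exact_mod_cast (inv_pos.2 hy).ne') hz0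
  have hw : ((y⁻¹ : ℝ) : ℂ) * z ∈ Complex.slitPlane := by
    rw [Complex.mem_slitPlane_iff_arg, Complex.arg_real_mul z (inv_pos.2 hy)]
    exact ⟨(Complex.mem_slitPlane_iff_arg.1 hz).1, hw0⟩
  have key := integral_Gamma_mul_Gamma_one_sub_mul_cpow h0 h1 hw
  have e : ∀ u : ℂ, (((y⁻¹ : ℝ) : ℂ) * z) ^ (-u) = z ^ (-u) * (y : ℂ) ^ u := by
    intro u
    rw [Complex.cpow_def_of_ne_zero hw0, Complex.cpow_def_of_ne_zero hz0,
      Complex.cpow_def_of_ne_zero hy0, hlog, ← Complex.exp_add, Complex.ofReal_log hy.le]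
    congr 1
    ring
  simp only [e, ← mul_assoc] at key
  rw [key]
  have hpi : (Real.pi : ℂ) ≠ 0 := by exact_mod_cast Real.pi_ne_zero
  have hzy : z + y ≠ 0 := fun h => by
    rw [show z = ((-y : ℝ) : ℂ) by push_cast; linear_combination h] at hz
    simp [Complex.slitPlane] at hz
    linarith
  push_cast
  have : 1 + (y : ℂ)⁻¹ * z = (z + y) / y := by field_simp; ring
  rw [this]
  field_simp

/-- The integrand whose two iterated integrals are the auxiliary function and its Mellin-Barnes
representation along `Re u = c`. -/
def mellinBarnesDouble (a b c : ℝ) (f : ℝ[X]) (z : ℂ) (t : ℝ) (w : ℝ × ℝ) : ℂ :=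
  (Complex.Gamma (c + t * Complex.I) * Complex.Gamma (1 - (c + t * Complex.I)) *
    z ^ (-(c + t * Complex.I))) *
  (((f.eval w.1 * w.1 ^ a * (Real.exp (-w.1 - w.2) / (w.1 + w.2)) : ℝ) : ℂ) *
    (w.2 : ℂ) ^ (((b + c : ℝ) : ℂ) - 1)) * Complex.exp ((t * Real.log w.2 : ℝ) * Complex.I)

/-- Only the phase `y^{it}`, of modulus one, couples `t` with `w`; the remainder is a product of an
integrable function of each. -/
theorem integrable_mellinBarnesDouble {a b c : ℝ} (ha : -1 < a) (h0 : 0 < c) (h1 : c < 1)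
    (hab : 0 < a + b + c) (hb : 0 < b + c) (f : ℝ[X]) {z : ℂ} (hz : z ∈ Complex.slitPlane) :
    Integrable (Function.uncurry (mellinBarnesDouble a b c f z))
      (volume.prod (volume.restrict (Ioi (0 : ℝ) ×ˢ Ioi (0 : ℝ)))) := by
  refine Integrable.mul_bdd (c := 1)
    ((integrable_Gamma_mul_Gamma_one_sub_mul_cpow h0 h1 hz).mul_prod
      (integrableOn_eval_mul_cpow ha f (B := ((b + c : ℝ) : ℂ))
        (by rw [Complex.ofReal_re]; exact hb) (by rw [Complex.ofReal_re]; linarith)))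
    (Measurable.aestronglyMeasurable (by fun_prop)) (Eventually.of_forall fun x => ?_)
  rw [Complex.norm_exp_ofReal_mul_I]

theorem mellinBarnesDouble_eq (a b c : ℝ) (f : ℝ[X]) (z : ℂ) (t : ℝ) {w : ℝ × ℝ}
    (hw : w ∈ Ioi (0 : ℝ) ×ˢ Ioi (0 : ℝ)) :
    mellinBarnesDouble a b c f z t w =
      (Complex.Gamma (c + t * Complex.I) * Complex.Gamma (1 - (c + t * Complex.I)) *
        z ^ (-(c + t * Complex.I))) *
      (((f.eval w.1 * w.1 ^ a * (Real.exp (-w.1 - w.2) / (w.1 + w.2)) : ℝ) : ℂ) *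
        (w.2 : ℂ) ^ ((b + (c + t * Complex.I)) - 1)) := by
  have hy : 0 < w.2 := hw.2
  have hy0 : (w.2 : ℂ) ≠ 0 := by exact_mod_cast hy.ne'
  rw [mellinBarnesDouble, show (b : ℂ) + (c + t * Complex.I) - 1 =
    (((b + c : ℝ) : ℂ) - 1) + t * Complex.I by push_cast; ring, Complex.cpow_add _ _ hy0,
    Complex.cpow_def_of_ne_zero hy0 (t * Complex.I), ← Complex.ofReal_log hy.le,
    show (Real.log w.2 : ℂ) * (t * Complex.I) = (t * Real.log w.2 : ℝ) * Complex.I by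
      push_cast; ring]
  ring

theorem auxSecondIntegrand_eq_integral {a b c : ℝ} (h0 : 0 < c) (h1 : c < 1) (f : ℝ[X]) {z : ℂ}
    (hz : z ∈ Complex.slitPlane) {w : ℝ × ℝ} (hw : w ∈ Ioi (0 : ℝ) ×ˢ Ioi (0 : ℝ)) :
    auxSecondIntegrand a b f z w =
      (2 * (Real.pi : ℂ))⁻¹ * ∫ t : ℝ, mellinBarnesDouble a b c f z t w := by
  have hy : 0 < w.2 := hw.2
  have hy0 : (w.2 : ℂ) ≠ 0 := by exact_mod_cast hy.ne'
  have e : ∀ t : ℝ, mellinBarnesDouble a b c f z t w =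
      (Complex.Gamma (c + t * Complex.I) * Complex.Gamma (1 - (c + t * Complex.I)) *
        z ^ (-(c + t * Complex.I)) * (w.2 : ℂ) ^ (c + t * Complex.I)) *
      (((f.eval w.1 * w.1 ^ a * (Real.exp (-w.1 - w.2) / (w.1 + w.2)) : ℝ) : ℂ) *
        ((w.2 ^ b : ℝ) : ℂ) / w.2) := by
    intro t
    rw [mellinBarnesDouble_eq a b c f z t hw, Complex.cpow_sub _ _ hy0, Complex.cpow_one,
      Complex.cpow_add _ _ hy0, Complex.ofReal_cpow hy.le]
    ring
  simp only [e]
  rw [integral_mul_const, ← mul_assoc, ← div_add_eq_integral h0 h1 hz hy, auxSecondIntegrand]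
  push_cast
  rw [← div_div]
  field_simp

end

theorem mainTheorem9 (a b : ℝ) (ha : -1 < a) (hb : -1 < b) (hab : -1 < a + b)
    (p q : ℕ → ℝ[X]) (hpq : IsCauchyLaguerreBiorthonormal a b p q)
    (n : ℕ) (z : ℂ) (hz : z ∈ Complex.slitPlane) :
    IntegrableOn (auxSecondIntegrand a b (p n) z) (Ioi (0 : ℝ) ×ˢ Ioi (0 : ℝ)) ∧
    ∃ g : ℂ,
      HasMeijerG 3 1 ![-(n : ℂ), ((a + b : ℝ) : ℂ) + n + 1] ![0, ((a + b : ℝ) : ℂ), (b : ℂ)] z g ∧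
      auxSecond a b (p n) z = (-1) ^ (n + 1) * (normConst a b n : ℂ) * g := by
  -- The interval is nonempty because `α > -1` and `b > -1`.
  obtain ⟨c, hc, hc1⟩ : ∃ c, max 0 (max (-(a + b)) (-b)) < c ∧ c < 1 :=
    exists_between (max_lt one_pos (max_lt (by linarith) (by linarith)))
  obtain ⟨hc0, hc'⟩ := max_lt_iff.1 hc
  obtain ⟨hca, hcb⟩ := max_lt_iff.1 hc'
  have hca : 0 < a + b + c := by linarith
  have hcb : 0 < b + c := by linarith
  have hm : MeasurableSet (Ioi (0 : ℝ) ×ˢ Ioi (0 : ℝ)) := measurableSet_Ioi.prod measurableSet_Ioi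
  have hint := integrable_mellinBarnesDouble ha hc0 hc1 hca hcb (p n) hz
  refine ⟨?_, _, hasMeijerG_vertical n hz hc0 hc1 hca hcb, ?_⟩
  -- Absolute convergence comes from Fubini: up to a constant, the integrand is the `t`-integral of
  -- an integrable function of `(t, w)`.
  · have h := hint.integral_prod_right.const_mul (2 * (Real.pi : ℂ))⁻¹
    refine Integrable.congr h ?_
    filter_upwards [ae_restrict_mem hm] with w hw
    exact (auxSecondIntegrand_eq_integral hc0 hc1 (p n) hz hw).symm
  · rw [auxSecond, setIntegral_congr_fun hm fun w hw =>
      auxSecondIntegrand_eq_integral hc0 hc1 (p n) hz hw, integral_const_mul,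
      ← integral_integral_swap hint]
    have e : ∀ t : ℝ, ∫ w in Ioi (0 : ℝ) ×ˢ Ioi (0 : ℝ), mellinBarnesDouble a b c (p n) z t w =
        (-1) ^ n * (normConst a b n : ℂ) *
          meijerIntegrand 3 1 ![-(n : ℂ), ((a + b : ℝ) : ℂ) + n + 1]
            ![0, ((a + b : ℝ) : ℂ), (b : ℂ)] z (c + t * Complex.I) := by
      intro t
      have hre : ((c : ℂ) + t * Complex.I).re = c := re_ofReal_add_mul_I c t
      have hαu : ∀ k : ℕ, ((a + b : ℝ) : ℂ) + (c + t * Complex.I) + k ≠ 0 := fun k h => by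
        have hk : (0 : ℝ) ≤ k := k.cast_nonneg
        have := congrArg Complex.re h
        simp at this
        linarith
      have hu : ∀ k < n, 1 - ((c : ℂ) + t * Complex.I) + (k : ℕ) ≠ 0 := fun k _ h => by
        have hk : (0 : ℝ) ≤ k := k.cast_nonneg
        have := congrArg Complex.re h
        simp at this
        linarith
      have hs : (a : ℂ) + (b + (c + t * Complex.I)) = (a + b : ℝ) + (c + t * Complex.I) := by
        push_cast; ring
      rw [setIntegral_congr_fun hm fun w hw => mellinBarnesDouble_eq a b c (p n) z t hw,
        integral_const_mul, integral_eval_mul_cpow ha (p n)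
          (by rw [Complex.add_re, hre, Complex.ofReal_re]; exact hcb)
          (by rw [Complex.add_re, hre, Complex.ofReal_re]; linarith), hs,
        hpq.cauchyMoment_eq ha hb hab n hαu, meijerIntegrand_eq_ratio a b n z _ hu hαu,
        cauchyLaguerreRatio]
      -- With `s = α + u` the zeros contribute `∏ (u - k - 1) = (-1)^n (1 - u)_n`; the remaining
      -- sign in `(-1)^{n+1}` is the one in the definition of `auxSecond`.
      have hprod : ∏ k ∈ Finset.range n,
          (((a + b : ℝ) : ℂ) + (c + t * Complex.I) - (a + b : ℝ) - (k + 1)) =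
          (-1) ^ n * ∏ k ∈ Finset.range n, ((k : ℂ) + 1 - (c + t * Complex.I)) := by
        rw [show (-1 : ℂ) ^ n = (-1) ^ (Finset.range n).card by rw [Finset.card_range],
          ← Finset.prod_neg]
        exact Finset.prod_congr rfl fun k _ => by ring
      rw [hprod]
      ring
    simp only [e]
    rw [integral_const_mul]
    ring
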